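/- For $A\in M_n(\mathbb{C})$ let $|A|=(A^*A)^{1/2}$, and let $s_1(A)\ge\cdots\ge s_n(A)\ge 0$ be the singular values of $A$. For $1\le q<\infty$ let $\|A\|_q=\bigl(\sum_{j=1}^n s_j(A)^q\bigr)^{1/q}$ be the Schatten $q$-norm, and let $\|A\|_\infty=s_1(A)$. For a positive semidefinite matrix $X$ and a function $f:[0,\infty)\to[0,\infty)$, the matrix $f(X)$ is defined by the spectral theorem (functional calculus). The function $f$ is called geometrically convex if $f(\sqrt{ab})\le\sqrt{f(a)f(b)}$ for all $a,b>0$. Proposition. Let $f:[0,\infty)\to[0,\infty)$ be concave and geometrically convex. Then for every $m\ge 1$, all $A_1,\dots,A_m\in M_n(\mathbb{C})$ and every $1\le q\le\infty$, $$\bigl\|f(|A_1+\cdots+A_m|)\bigr\|_q\le(\sqrt m)^{\,1-1/q}\,\bigl\|f(|A_1|)+\cdots+f(|A_m|)\bigr\|_q,$$ where $1/q=0$ for $q=\infty$. -/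

import Mathlib

open scoped ENNReal MatrixOrder

/-- `f : [0, ∞) → [0, ∞)` is geometrically convex: `f (√(a b)) ≤ √(f a * f b)` for all `a, b > 0`. -/
def GeometricallyConvex (f : ℝ → ℝ) : Prop :=
  ∀ a b : ℝ, 0 < a → 0 < b → f (√(a * b)) ≤ √(f a * f b)

/-- The singular values `s_0(A) ≥ s_1(A) ≥ ⋯ ≥ s_{n-1}(A) ≥ 0` of an `n × n` complex matrix,
indexed from `0`, with multiplicity: those of `A` acting on the Hilbert space `ℂⁿ`.
The value is `0` at every index `j ≥ n`. -/
noncomputable def matrixSingularValue {n : ℕ} (A : Matrix (Fin n) (Fin n) ℂ) (j : ℕ) : ℝ :=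
  (Matrix.toEuclideanLin A).singularValues j

/-- The Schatten `q`-norm of an `n × n` complex matrix for `1 ≤ q ≤ ∞`: the `ℓ^q` norm of its
singular values, which for `q = ∞` is the largest singular value. -/
noncomputable def schattenNorm {n : ℕ} (q : ℝ≥0∞) (A : Matrix (Fin n) (Fin n) ℂ) : ℝ :=
  if q = ∞ then matrixSingularValue A 0
  else (∑ j : Fin n, matrixSingularValue A j ^ q.toReal) ^ (1 / q.toReal)

/-!
Write `M = ∑ A i`. For each `A` the block matrix with diagonal blocks `A |A|⁻¹ A* = |A*|` and `|A|`
and off-diagonal block `A` is positive semidefinite; summing over `i` gives a positive semidefinite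
block matrix with diagonal blocks `P = ∑ |A i *|`, `Q = ∑ |A i|` and off-diagonal block `M`.
Compressing it to the top `k` singular vectors of `M` and comparing determinants shows that the
singular values of `M` are log-majorized by `√(a j * b j)`, where `a` and `b` are the decreasingly
ordered eigenvalues of `P` and `Q` (`Matrix.prod_sq_eigenvalues_le`). Geometric convexity makes
`x ↦ f (exp x) ^ q` convex, and it is increasing as `f` is concave and nonnegative, so
log-majorization turns into `∑ f (s j) ^ q ≤ ∑ f √(a j * b j) ^ q`. Geometric convexity again
and the Cauchy–Schwarz inequality yield `(Tr f(|M|)^q)² ≤ Tr f(P)^q * Tr f(Q)^q`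
(`GeometricallyConvex.sq_sum_rpow_le`).

It remains to bound both factors by `R = Tr (∑ f(|A i|))^q`. For `Q` this is the subadditivity
`Tr f(∑ X i)^q ≤ Tr (∑ f(X i))^q` of concave functions on positive semidefinite matrices
(`Matrix.sum_concave_rpow_le`). Its proof works in an eigenbasis of `X = ∑ X i`, with eigenvalues
`x j`: if `v` is a unit eigenvector of `X i` with eigenvalue `a > 0`, then `a v v* ≤ X` gives
`∑ |⟪e j, v⟫|² / x j ≤ 1 / a`, and with a tangent line of `f` at `a` one gets
`Tr V(X) f(X) ≤ Tr V(X) ∑ f(X i)` for every increasing `V ≥ 0`; take `V = f ^ (q - 1)` and use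
Young's inequality. For `P` the same argument followed by the power mean inequality gives
`Tr f(P)^q ≤ m ^ (q - 1) * ∑ Tr f(|A i *|)^q`. As `|A i *|` and `|A i|` have the same eigenvalues,
superadditivity of `Tr (·)^q` bounds this by `m ^ (q - 1) * R`. Superadditivity is itself the
subadditivity of `t ↦ t ^ (1 / q)` (`Matrix.sum_sum_rpow_le`).

Altogether `Tr f(|M|)^q ≤ (√m) ^ (q - 1) * R`, and `q`-th roots give the claim for finite `q`.
The case `q = ∞` follows by letting `q → ∞`.
-/

open scoped ComplexOrder

/-! ### Spectral decomposition, functional calculus and singular values -/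

open Matrix in
/-- `g(H)` has the eigenvectors of `H`, with eigenvalues `g λ`. No continuity of `g` is needed, as
the spectrum is finite. -/
theorem Matrix.IsHermitian.toEuclideanLin_cfc_eigenvectorBasis {n : Type*} [Fintype n]
    [DecidableEq n] {H : Matrix n n ℂ} (hH : H.IsHermitian) (g : ℝ → ℝ) (l : n) :
    toEuclideanLin (cfc g H) (hH.eigenvectorBasis l) =
      ((g (hH.eigenvalues l) : ℝ) : ℂ) • hH.eigenvectorBasis l := by
  rw [hH.cfc_eq, IsHermitian.cfc, Unitary.conjStarAlgAut_apply]
  apply WithLp.ofLp_injective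
  simp only [toLpLin_apply, ← mulVec_mulVec, WithLp.ofLp_smul]
  rw [hH.star_eigenvectorUnitary_mulVec, diagonal_mulVec_single]
  have : (Pi.single l ((RCLike.ofReal ∘ g ∘ hH.eigenvalues) l * 1) : n → ℂ) =
      ((g (hH.eigenvalues l) : ℝ) : ℂ) • Pi.single l 1 := by
    rw [← Pi.single_smul]; simp
  rw [this, mulVec_smul, hH.eigenvectorUnitary_mulVec]

/-- The real quadratic form `x ↦ Re ⟪x, H x⟫` of a complex matrix. -/
noncomputable def Matrix.quadForm {n : Type*} [Fintype n] [DecidableEq n] (H : Matrix n n ℂ)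
    (x : EuclideanSpace ℂ n) : ℝ :=
  RCLike.re (inner ℂ x (Matrix.toEuclideanLin H x))

namespace Matrix

variable {n : Type*} [Fintype n] [DecidableEq n]

theorem quadForm_sum {ι : Type*} (s : Finset ι) (H : ι → Matrix n n ℂ)
    (x : EuclideanSpace ℂ n) : quadForm (∑ i ∈ s, H i) x = ∑ i ∈ s, quadForm (H i) x := by
  simp [quadForm, map_sum, LinearMap.sum_apply]

theorem PosSemidef.quadForm_nonneg {H : Matrix n n ℂ} (hH : H.PosSemidef)
    (x : EuclideanSpace ℂ n) : 0 ≤ quadForm H x := by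
  have h := hH.re_dotProduct_nonneg x.ofLp
  have : quadForm H x = RCLike.re (star x.ofLp ⬝ᵥ (H *ᵥ x.ofLp)) := by
    rw [quadForm, EuclideanSpace.inner_eq_star_dotProduct, dotProduct_comm]
    simp [toLpLin_apply]
  rw [this]; exact h

theorem isHermitian_cfc {H : Matrix n n ℂ} (g : ℝ → ℝ) : (cfc g H).IsHermitian :=
  cfc_predicate g H

theorem quadForm_cfc {H : Matrix n n ℂ} (hH : H.IsHermitian) (g : ℝ → ℝ)
    (x : EuclideanSpace ℂ n) :
    quadForm (cfc g H) x =
      ∑ l, g (hH.eigenvalues l) * ‖inner ℂ (hH.eigenvectorBasis l) x‖ ^ 2 := by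
  have hs := isSymmetric_toEuclideanLin_iff.mpr (isHermitian_cfc (H := H) g)
  rw [quadForm, ← hH.eigenvectorBasis.sum_inner_mul_inner, map_sum]
  refine Finset.sum_congr rfl fun l _ => ?_
  rw [← hs, hH.toEuclideanLin_cfc_eigenvectorBasis, inner_smul_left, Complex.conj_ofReal,
    ← inner_conj_symm x, mul_left_comm, RCLike.conj_mul]
  rw [← RCLike.ofReal_pow, RCLike.re_eq_complex_re]
  exact Complex.re_ofReal_mul _ _

theorem IsHermitian.quadForm_eq {H : Matrix n n ℂ} (hH : H.IsHermitian)
    (x : EuclideanSpace ℂ n) :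
    quadForm H x = ∑ l, hH.eigenvalues l * ‖inner ℂ (hH.eigenvectorBasis l) x‖ ^ 2 := by
  have := quadForm_cfc hH id x
  rwa [cfc_id ℝ H hH.isSelfAdjoint] at this

theorem IsHermitian.quadForm_eigenvectorBasis {H : Matrix n n ℂ} (hH : H.IsHermitian) (j : n) :
    quadForm H (hH.eigenvectorBasis j) = hH.eigenvalues j := by
  rw [hH.quadForm_eq, Finset.sum_eq_single j]
  · simp
  · intro l _ hl
    rw [hH.eigenvectorBasis.inner_eq_zero hl]; simp
  · simp

/-- The trace can be computed in any orthonormal basis. -/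
theorem IsHermitian.sum_quadForm {H : Matrix n n ℂ} (hH : H.IsHermitian)
    (e : OrthonormalBasis n ℂ (EuclideanSpace ℂ n)) :
    ∑ j, quadForm H (e j) = ∑ l, hH.eigenvalues l := by
  simp_rw [hH.quadForm_eq]
  rw [Finset.sum_comm]
  refine Finset.sum_congr rfl fun l _ => ?_
  rw [← Finset.mul_sum, e.sum_sq_norm_inner_left]
  simp

/-- The eigenvalues are determined, as a multiset, by the characteristic polynomial. -/
theorem IsHermitian.sum_eigenvalues_of_charpoly {H : Matrix n n ℂ} (hH : H.IsHermitian)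
    {d : n → ℝ} (hd : H.charpoly = ∏ i, (Polynomial.X - Polynomial.C (d i : ℂ))) (φ : ℝ → ℝ) :
    ∑ i, φ (hH.eigenvalues i) = ∑ i, φ (d i) := by
  have h1 : Multiset.map (fun i => ((hH.eigenvalues i : ℝ) : ℂ)) Finset.univ.val =
      Multiset.map (fun i => (d i : ℂ)) Finset.univ.val := by
    have := hH.roots_charpoly_eq_eigenvalues
    rw [hd, Polynomial.roots_prod _ _ (by
      simp [Finset.prod_ne_zero_iff, Polynomial.X_sub_C_ne_zero])] at this
    simpa [Function.comp_def] using this.symm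
  have h2 := congrArg (fun s => (s.map fun z : ℂ => φ z.re).sum) h1
  simpa [Multiset.map_map, Function.comp_def] using h2

theorem IsHermitian.sum_eigenvalues_cfc {H K : Matrix n n ℂ} (hH : H.IsHermitian)
    (hK : K.IsHermitian) (g : ℝ → ℝ) (h : K = cfc g H) (φ : ℝ → ℝ) :
    ∑ i, φ (hK.eigenvalues i) = ∑ i, φ (g (hH.eigenvalues i)) := by
  subst h
  exact hK.sum_eigenvalues_of_charpoly (hH.charpoly_cfc_eq g) φ

end Matrix

open Matrix in
theorem charpoly_conjTranspose_mul_self {n : ℕ} (B : Matrix (Fin n) (Fin n) ℂ) :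
    (Bᴴ * B).charpoly = ∏ i : Fin n,
      (Polynomial.X - Polynomial.C (((matrixSingularValue B i ^ 2 : ℝ)) : ℂ)) := by
  have h0 : LinearMap.adjoint (toEuclideanLin B) ∘ₗ toEuclideanLin B =
      toEuclideanLin (Bᴴ * B) := by
    rw [← Matrix.toEuclideanLin_conjTranspose_eq_adjoint]
    ext x
    simp [toLpLin_apply]
  have hch : (LinearMap.adjoint (toEuclideanLin B) ∘ₗ toEuclideanLin B).charpoly =
      (Bᴴ * B).charpoly := by
    rw [h0, toEuclideanLin_eq_toLin_orthonormal,
      ← LinearMap.charpoly_toMatrix _ (EuclideanSpace.basisFun (Fin n) ℂ).toBasis,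
      LinearMap.toMatrix_toLin]
  have hn : Module.finrank ℂ (EuclideanSpace ℂ (Fin n)) = n := finrank_euclideanSpace_fin
  rw [← hch, LinearMap.IsSymmetric.charpoly_eq (LinearMap.isSymmetric_adjoint_comp_self _) hn]
  refine Finset.prod_congr rfl fun i _ => ?_
  rw [matrixSingularValue, LinearMap.sq_singularValues_fin _ hn]
  rfl

open Matrix in
/-- Symmetric functions of the singular values of `B` are read off the eigenvalues of `B* B`. -/
theorem sum_matrixSingularValue {n : ℕ} (B : Matrix (Fin n) (Fin n) ℂ) (φ : ℝ → ℝ) :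
    ∑ j : Fin n, φ (matrixSingularValue B j) =
      ∑ i, φ √((isHermitian_conjTranspose_mul_self B).eigenvalues i) := by
  rw [IsHermitian.sum_eigenvalues_of_charpoly _ (charpoly_conjTranspose_mul_self B)
    (fun x => φ √x)]
  refine Finset.sum_congr rfl fun j _ => ?_
  rw [Real.sqrt_sq]
  exact LinearMap.singularValues_nonneg _ _

open Matrix in
/-- For a positive semidefinite matrix the singular values are the eigenvalues. -/
theorem Matrix.PosSemidef.sum_matrixSingularValue {n : ℕ} {B : Matrix (Fin n) (Fin n) ℂ}
    (hB : B.PosSemidef) (φ : ℝ → ℝ) :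
    ∑ j : Fin n, φ (matrixSingularValue B j) = ∑ i, φ (hB.isHermitian.eigenvalues i) := by
  rw [_root_.sum_matrixSingularValue]
  have : Bᴴ * B = cfc (fun x : ℝ => x ^ 2) B := by
    have hB' : IsSelfAdjoint B := hB.isHermitian
    rw [cfc_pow_id B 2 hB', hB.isHermitian.eq, sq]
  rw [hB.isHermitian.sum_eigenvalues_cfc _ _ this (fun x => φ √x)]
  refine Finset.sum_congr rfl fun j _ => ?_
  rw [Real.sqrt_sq (hB.eigenvalues_nonneg j)]

/-! ### Subadditivity of concave functions under a monotone weight -/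

/-- A convex function lies above its right tangent at an interior point. -/
theorem ConvexOn.add_rightDeriv_mul_le {S : Set ℝ} {ψ : ℝ → ℝ} (hψ : ConvexOn ℝ S ψ) {x y : ℝ}
    (hx : x ∈ interior S) (hy : y ∈ S) :
    ψ x + derivWithin ψ (Set.Ioi x) x * (y - x) ≤ ψ y := by
  rcases lt_trichotomy x y with h | rfl | h
  · have h1 := hψ.rightDeriv_le_slope_of_mem_interior hx hy h
    rw [slope_def_field, le_div_iff₀ (sub_pos.2 h)] at h1
    linarith
  · simp
  · have h1 := (hψ.slope_le_leftDeriv_of_mem_interior hy hx h).trans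
      (hψ.leftDeriv_le_rightDeriv_of_mem_interior hx)
    rw [slope_def_field, div_le_iff₀ (sub_pos.2 h)] at h1
    linarith

/-- If `f` is dominated by the line `α + c x`, with equality at `a` and `0 ≤ α`, and the weights `μ`
satisfy `a ∑ μ j / x j ≤ 1`, then the `V`-weighted average of `f (x j) / x j` is at most `f a / a`.
As `V` is monotone, `V (x j) (1 / x j - 1 / a) ≤ V a (1 / x j - 1 / a)` for every `j`. -/
theorem sum_mul_div_le_of_tangent {ι : Type*} [Fintype ι] {μ x : ι → ℝ} {a α c : ℝ}
    {f V : ℝ → ℝ} (ha : 0 < a) (hμ : ∀ j, 0 ≤ μ j) (hμ1 : ∑ j, μ j = 1) (hx : ∀ j, 0 ≤ x j)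
    (hμx : ∀ j, x j = 0 → μ j = 0) (hsum : a * ∑ j, μ j * (x j)⁻¹ ≤ 1) (hα : 0 ≤ α)
    (hfa : f a = α + c * a) (hf : ∀ t, 0 ≤ t → f t ≤ α + c * t)
    (hV : MonotoneOn V (Set.Ici 0)) (hV0 : ∀ t, 0 ≤ t → 0 ≤ V t) :
    ∑ j, V (x j) * (f (x j) / x j) * (a * μ j) ≤ f a * ∑ j, V (x j) * μ j := by
  have h1 : ∀ j, V (x j) * (f (x j) / x j) * (a * μ j) ≤
      α * (a * (V a * (μ j * (x j)⁻¹)) + μ j * V (x j) - V a * μ j)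
        + c * a * (V (x j) * μ j) := by
    intro j
    rcases (hx j).eq_or_lt with h0 | h0
    · simp [hμx j h0.symm]
    · have h2 : (V (x j) - V a) * ((x j)⁻¹ * a - 1) ≤ 0 := by
        rcases le_total (x j) a with h | h
        · refine mul_nonpos_of_nonpos_of_nonneg (sub_nonpos.2 (hV h0.le ha.le h)) ?_
          rw [sub_nonneg, inv_mul_eq_div, le_div_iff₀ h0]; linarith
        · refine mul_nonpos_of_nonneg_of_nonpos (sub_nonneg.2 (hV ha.le h0.le h)) ?_
          rw [sub_nonpos, inv_mul_eq_div, div_le_iff₀ h0]; linarith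
      have h3 : V (x j) * (f (x j) / x j) * (a * μ j) ≤
          V (x j) * ((α + c * x j) / x j) * (a * μ j) := by
        have := hf (x j) h0.le
        have := hV0 (x j) h0.le
        have := hμ j
        gcongr
      refine h3.trans ?_
      have h4 : V (x j) * ((α + c * x j) / x j) * (a * μ j) =
          α * μ j * (V (x j) * ((x j)⁻¹ * a)) + c * a * (V (x j) * μ j) := by
        field_simp
      rw [h4]
      have h5 : α * μ j * (V (x j) * ((x j)⁻¹ * a)) ≤
          α * μ j * (V a * ((x j)⁻¹ * a) + V (x j) - V a) :=
        mul_le_mul_of_nonneg_left (by linarith) (mul_nonneg hα (hμ j))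
      linarith
  refine (Finset.sum_le_sum fun j _ => h1 j).trans ?_
  rw [Finset.sum_add_distrib, ← Finset.mul_sum, ← Finset.mul_sum, Finset.sum_sub_distrib,
    Finset.sum_add_distrib, ← Finset.mul_sum, ← Finset.mul_sum, ← Finset.mul_sum, hμ1, hfa]
  have h6 : V a * (a * ∑ j, μ j * (x j)⁻¹) ≤ V a * 1 :=
    mul_le_mul_of_nonneg_left hsum (hV0 a ha.le)
  have h7 : α * (a * (V a * ∑ j, μ j * (x j)⁻¹) - V a * 1) ≤ 0 :=
    mul_nonpos_of_nonneg_of_nonpos hα (by linarith)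
  have h8 : ∑ j, μ j * V (x j) = ∑ j, V (x j) * μ j :=
    Finset.sum_congr rfl fun j _ => mul_comm _ _
  rw [h8]
  linarith

namespace Matrix

variable {n : Type*} [Fintype n] [DecidableEq n]

/-- If `a v v* ≤ X` then `v` is orthogonal to the kernel of `X`. -/
theorem IsHermitian.inner_eigenvectorBasis_eq_zero {X : Matrix n n ℂ} (hX : X.IsHermitian)
    {v : EuclideanSpace ℂ n} {a : ℝ} (ha : 0 < a)
    (h : ∀ y, a * ‖inner ℂ v y‖ ^ 2 ≤ quadForm X y) {j : n} (hj : hX.eigenvalues j = 0) :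
    ‖inner ℂ (hX.eigenvectorBasis j) v‖ ^ 2 = 0 := by
  have := h (hX.eigenvectorBasis j)
  rw [hX.quadForm_eigenvectorBasis, hj, norm_inner_symm] at this
  nlinarith [sq_nonneg ‖inner ℂ (hX.eigenvectorBasis j) v‖]

/-- If `a v v* ≤ X` then `a ⟪v, X⁻¹ v⟫ ≤ 1`, with `X⁻¹` the pseudo-inverse. -/
theorem IsHermitian.mul_sum_inv_eigenvalues_le_one {X : Matrix n n ℂ} (hX : X.IsHermitian)
    {v : EuclideanSpace ℂ n} {a : ℝ} (h : ∀ y, a * ‖inner ℂ v y‖ ^ 2 ≤ quadForm X y)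
    (hx : ∀ j, 0 ≤ hX.eigenvalues j) :
    a * ∑ j, ‖inner ℂ (hX.eigenvectorBasis j) v‖ ^ 2 * (hX.eigenvalues j)⁻¹ ≤ 1 := by
  set e := hX.eigenvectorBasis with he
  set x := hX.eigenvalues with hxdef
  set W := ∑ j, ‖inner ℂ (e j) v‖ ^ 2 * (x j)⁻¹ with hW
  -- the test vector is `y = X⁻¹ v`
  set y : EuclideanSpace ℂ n := ∑ j, (((x j)⁻¹ : ℝ) * inner ℂ (e j) v : ℂ) • e j with hy
  have h1 : ∀ l, inner ℂ (e l) y = ((x l)⁻¹ : ℝ) * inner ℂ (e l) v := by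
    intro l
    rw [hy, inner_sum, Finset.sum_eq_single l]
    · rw [inner_smul_right, inner_self_eq_norm_sq_to_K, e.norm_eq_one]; simp
    · intro b _ hb
      rw [inner_smul_right, e.inner_eq_zero hb.symm, mul_zero]
    · simp
  have h2 : quadForm X y = W := by
    rw [hX.quadForm_eq, hW]
    refine Finset.sum_congr rfl fun l _ => ?_
    rw [← he, h1, norm_mul, mul_pow, Complex.norm_real, Real.norm_eq_abs, sq_abs, ← hxdef]
    rcases eq_or_ne (x l) 0 with h0 | h0
    · simp [h0]
    · field_simp
  have h3 : inner ℂ v y = (W : ℂ) := by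
    rw [← e.sum_inner_mul_inner, hW, Complex.ofReal_sum]
    refine Finset.sum_congr rfl fun l _ => ?_
    rw [h1, mul_left_comm, ← inner_conj_symm v, RCLike.conj_mul]
    push_cast
    exact mul_comm _ _
  have h4 := h y
  rw [h2, h3, Complex.norm_real, Real.norm_eq_abs, sq_abs] at h4
  have h5 : 0 ≤ W := Finset.sum_nonneg fun j _ => mul_nonneg (sq_nonneg _) (inv_nonneg.2 (hx j))
  rcases h5.eq_or_lt with h6 | h6
  · rw [← h6]; simp
  · exact le_of_mul_le_mul_right (by linarith) h6

/-- If `0 ≤ A ≤ X`, `V` is monotone and `f` is concave, then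
`Tr V(X) (f(X) / X) A ≤ Tr V(X) f(A)`, the traces being computed in an eigenbasis of `X`. -/
theorem PosSemidef.sum_mul_quadForm_le {A X : Matrix n n ℂ} (hA : A.PosSemidef)
    (hX : X.PosSemidef) (hAX : ∀ y, quadForm A y ≤ quadForm X y) {f V : ℝ → ℝ}
    (hf : ConcaveOn ℝ (Set.Ici 0) f) (hf0 : 0 ≤ f 0)
    (hV : MonotoneOn V (Set.Ici 0)) (hV0 : ∀ t, 0 ≤ t → 0 ≤ V t) :
    ∑ j, V (hX.isHermitian.eigenvalues j) *
        (f (hX.isHermitian.eigenvalues j) / hX.isHermitian.eigenvalues j) *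
        quadForm A (hX.isHermitian.eigenvectorBasis j) ≤
      ∑ j, V (hX.isHermitian.eigenvalues j) *
        quadForm (cfc f A) (hX.isHermitian.eigenvectorBasis j) := by
  set e := hX.isHermitian.eigenvectorBasis with he
  set x := hX.isHermitian.eigenvalues with hxdef
  set v := hA.isHermitian.eigenvectorBasis with hv
  set a := hA.isHermitian.eigenvalues with hadef
  have hx : ∀ j, 0 ≤ x j := hX.eigenvalues_nonneg
  have ha : ∀ j, 0 ≤ a j := hA.eigenvalues_nonneg
  have hL : ∀ j, V (x j) * (f (x j) / x j) * quadForm A (e j) =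
      ∑ l, V (x j) * (f (x j) / x j) * (a l * ‖inner ℂ (e j) (v l)‖ ^ 2) := by
    intro j
    rw [hA.isHermitian.quadForm_eq, Finset.mul_sum]
    simp_rw [norm_inner_symm (e j)]
    rfl
  have hR : ∀ j, V (x j) * quadForm (cfc f A) (e j) =
      ∑ l, f (a l) * (V (x j) * ‖inner ℂ (e j) (v l)‖ ^ 2) := by
    intro j
    rw [quadForm_cfc hA.isHermitian, Finset.mul_sum]
    simp_rw [norm_inner_symm (e j), mul_left_comm (V _)]
    rfl
  simp_rw [hL, hR]
  rw [Finset.sum_comm, Finset.sum_comm (γ := n) (f := fun j l => f (a l) * _)]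
  refine Finset.sum_le_sum fun l _ => ?_
  rw [← Finset.mul_sum]
  rcases (ha l).eq_or_lt with h0 | h0
  · rw [← h0]
    simp only [zero_mul, mul_zero, Finset.sum_const_zero]
    exact mul_nonneg hf0 (Finset.sum_nonneg fun j _ =>
      mul_nonneg (hV0 _ (hx j)) (sq_nonneg _))
  · have hdom : ∀ y, a l * ‖inner ℂ (v l) y‖ ^ 2 ≤ quadForm X y := by
      intro y
      refine le_trans ?_ (hAX y)
      rw [hA.isHermitian.quadForm_eq]
      exact Finset.single_le_sum (f := fun l => a l * ‖inner ℂ (v l) y‖ ^ 2)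
        (fun i _ => mul_nonneg (ha i) (sq_nonneg _)) (Finset.mem_univ l)
    have hmem : a l ∈ interior (Set.Ici (0 : ℝ)) := by simpa using h0
    set c := derivWithin (-f) (Set.Ioi (a l)) (a l)
    have htan : ∀ t, 0 ≤ t → f t ≤ (f (a l) + c * a l) + (-c) * t := by
      intro t ht
      have := hf.neg.add_rightDeriv_mul_le hmem ht
      simp only [Pi.neg_apply] at this
      linarith
    refine sum_mul_div_le_of_tangent (α := f (a l) + c * a l) (c := -c) h0
      (fun j => sq_nonneg _) ?_ hx
      (fun j hj => hX.isHermitian.inner_eigenvectorBasis_eq_zero h0 hdom hj)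
      (hX.isHermitian.mul_sum_inv_eigenvalues_le_one hdom hx) ?_ (by ring) htan hV hV0
    · rw [e.sum_sq_norm_inner_right, v.norm_eq_one, one_pow]
    · have := htan 0 le_rfl
      linarith

theorem quadForm_cfc_sub_const {A : Matrix n n ℂ} (hA : A.IsHermitian) (f : ℝ → ℝ) (b : ℝ)
    {y : EuclideanSpace ℂ n} (hy : ‖y‖ = 1) :
    quadForm (cfc (fun t => f t - b) A) y = quadForm (cfc f A) y - b := by
  rw [quadForm_cfc hA, quadForm_cfc hA]
  simp_rw [sub_mul, Finset.sum_sub_distrib, ← Finset.mul_sum]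
  rw [hA.eigenvectorBasis.sum_sq_norm_inner_right, hy]; simp

/-- **Subadditivity of concave functions under a monotone weight**: with `X = ∑ X i`,
`Tr V(X) f(X) ≤ Tr V(X) ∑ f(X i)`. -/
theorem sum_mul_concave_le {ι : Type*} [Fintype ι] [Nonempty ι] {X : ι → Matrix n n ℂ}
    (hX : ∀ i, (X i).PosSemidef) {S : Matrix n n ℂ} (hS : S.PosSemidef) (hSX : S = ∑ i, X i)
    {f V : ℝ → ℝ} (hf : ConcaveOn ℝ (Set.Ici 0) f) (hf0 : 0 ≤ f 0)
    (hV : MonotoneOn V (Set.Ici 0)) (hV0 : ∀ t, 0 ≤ t → 0 ≤ V t) :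
    ∑ j, V (hS.isHermitian.eigenvalues j) * f (hS.isHermitian.eigenvalues j) ≤
      ∑ j, V (hS.isHermitian.eigenvalues j) *
        ∑ i, quadForm (cfc f (X i)) (hS.isHermitian.eigenvectorBasis j) := by
  set e := hS.isHermitian.eigenvectorBasis with he
  set x := hS.isHermitian.eigenvalues with hxdef
  have hx : ∀ j, 0 ≤ x j := hS.eigenvalues_nonneg
  have hg : ConcaveOn ℝ (Set.Ici 0) (fun t => f t - f 0) := by
    simpa [sub_eq_add_neg] using! hf.add_const (-(f 0))
  have hle : ∀ i y, quadForm (X i) y ≤ quadForm S y := by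
    intro i y
    rw [hSX, quadForm_sum]
    exact Finset.single_le_sum (f := fun i => quadForm (X i) y)
      (fun i _ => (hX i).quadForm_nonneg y) (Finset.mem_univ i)
  have key := Finset.sum_le_sum fun i (_ : i ∈ Finset.univ) =>
    (hX i).sum_mul_quadForm_le hS (hle i) hg (by simp) hV hV0
  rw [Finset.sum_comm, Finset.sum_comm (f := fun i j => V _ * quadForm (cfc _ (X i)) _)] at key
  simp_rw [← Finset.mul_sum] at key
  have hL : ∀ j, (f (x j) - f 0) / x j * ∑ i, quadForm (X i) (e j) = f (x j) - f 0 := by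
    intro j
    rw [← quadForm_sum, ← hSX, hS.isHermitian.quadForm_eigenvectorBasis]
    rcases eq_or_ne (x j) 0 with h | h
    · simp [h]
    · exact div_mul_cancel₀ _ h
  simp_rw [mul_assoc, ← he, ← hxdef, hL] at key
  have hR : ∀ j, ∑ i, quadForm (cfc (fun t => f t - f 0) (X i)) (e j) ≤
      (∑ i, quadForm (cfc f (X i)) (e j)) - f 0 := by
    intro j
    simp_rw [quadForm_cfc_sub_const (hX _).isHermitian f (f 0) (e.norm_eq_one j)]
    rw [Finset.sum_sub_distrib, Finset.sum_const, nsmul_eq_mul]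
    have h1 : (1 : ℝ) ≤ (Finset.univ : Finset ι).card := by
      exact_mod_cast Finset.card_pos.2 Finset.univ_nonempty
    nlinarith
  have key2 := key.trans (Finset.sum_le_sum fun j _ =>
    mul_le_mul_of_nonneg_left (hR j) (hV0 _ (hx j)))
  simp_rw [mul_sub, Finset.sum_sub_distrib] at key2
  linarith

end Matrix

/-! ### Subadditivity and superadditivity in Schatten norms -/

/-- A nonnegative concave function on a half-line cannot decrease: it would become negative. -/
theorem ConcaveOn.monotoneOn_of_nonneg {f : ℝ → ℝ} (hf : ConcaveOn ℝ (Set.Ici 0) f)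
    (hf0 : ∀ t, 0 ≤ t → 0 ≤ f t) : MonotoneOn f (Set.Ici 0) := by
  intro x hx y hy hxy
  rcases hxy.eq_or_lt with rfl | hxy
  · exact le_rfl
  by_contra! h
  have hd : 0 < (f x - f y) / (y - x) := div_pos (sub_pos.2 h) (sub_pos.2 hxy)
  set d := (f x - f y) / (y - x) with hd'
  -- past `y` the graph stays below a line of slope `-d`, which reaches `-1` at `z`
  set z := y + (f y + 1) / d with hz
  have hfy := hf0 y hy
  have hyz : y < z := by
    have : 0 < (f y + 1) / d := by positivity
    linarith
  have h0z : 0 ≤ z := le_trans hy hyz.le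
  have h1 := hf.slope_anti_adjacent hx h0z hxy hyz
  have h2 : (f y - f x) / (y - x) = -d := by rw [hd', ← neg_div, neg_sub]
  rw [h2, div_le_iff₀ (sub_pos.2 hyz), hz, add_sub_cancel_left, neg_mul,
    mul_div_cancel₀ _ hd.ne'] at h1
  have := hf0 z h0z
  rw [hz] at this
  linarith

/-- Young's inequality for the exponents `q / (q - 1)` and `q`, without denominators so that
`q = 1` is allowed. -/
theorem Real.mul_rpow_sub_one_mul_le {q u t : ℝ} (hq : 1 ≤ q) (hu : 0 ≤ u) (ht : 0 ≤ t) :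
    q * (u ^ (q - 1) * t) ≤ (q - 1) * u ^ q + t ^ q := by
  have hq0 : 0 < q := by linarith
  have h := Real.geom_mean_le_arith_mean2_weighted (w₁ := (q - 1) / q) (w₂ := 1 / q)
    (div_nonneg (by linarith) hq0.le) (by positivity) (Real.rpow_nonneg hu q)
    (Real.rpow_nonneg ht q) (by field_simp; ring)
  rw [← Real.rpow_mul hu, ← Real.rpow_mul ht, mul_div_cancel₀ _ hq0.ne',
    mul_div_cancel₀ _ hq0.ne', Real.rpow_one] at h
  calc q * (u ^ (q - 1) * t) ≤ q * ((q - 1) / q * u ^ q + 1 / q * t ^ q) := by gcongr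
    _ = _ := by field_simp

namespace Matrix

variable {n : Type*} [Fintype n] [DecidableEq n]

/-- Peierls' inequality: diagonal entries in any orthonormal basis have at most the `ℓ^q` norm of
the eigenvalues. -/
theorem PosSemidef.sum_quadForm_rpow_le {T : Matrix n n ℂ} (hT : T.PosSemidef) {q : ℝ}
    (hq : 1 ≤ q) (e : OrthonormalBasis n ℂ (EuclideanSpace ℂ n)) :
    ∑ j, quadForm T (e j) ^ q ≤ ∑ l, hT.isHermitian.eigenvalues l ^ q := by
  set v := hT.isHermitian.eigenvectorBasis with hv
  set a := hT.isHermitian.eigenvalues with ha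
  have h : ∀ j, quadForm T (e j) ^ q ≤ ∑ l, ‖inner ℂ (v l) (e j)‖ ^ 2 * a l ^ q := by
    intro j
    rw [hT.isHermitian.quadForm_eq]
    simp_rw [mul_comm (hT.isHermitian.eigenvalues _)]
    refine Real.rpow_arith_mean_le_arith_mean_rpow _ _ _ (fun l _ => sq_nonneg _) ?_
      (fun l _ => hT.eigenvalues_nonneg l) hq
    rw [v.sum_sq_norm_inner_right, e.norm_eq_one, one_pow]
  refine (Finset.sum_le_sum fun j _ => h j).trans ?_
  rw [Finset.sum_comm]
  refine Finset.sum_le_sum fun l _ => ?_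
  rw [← Finset.sum_mul, e.sum_sq_norm_inner_left, v.norm_eq_one, one_pow, one_mul]

theorem posSemidef_cfc {A : Matrix n n ℂ} (hA : A.PosSemidef) {f : ℝ → ℝ}
    (hf : ∀ t, 0 ≤ t → 0 ≤ f t) : (cfc f A).PosSemidef := by
  rw [← nonneg_iff_posSemidef]
  refine cfc_nonneg fun x hx => hf x ?_
  rw [hA.isHermitian.spectrum_real_eq_range_eigenvalues] at hx
  obtain ⟨i, rfl⟩ := hx
  exact hA.eigenvalues_nonneg i

variable {ι : Type*} [Fintype ι] [Nonempty ι] {X : ι → Matrix n n ℂ}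

/-- The weight `V = f ^ (q - 1)` and Young's inequality bound `Tr f(X)^q` by the diagonal entries
of `∑ f(X i)` in an eigenbasis of `X = ∑ X i`. -/
theorem sum_rpow_le_sum_quadForm_cfc (hX : ∀ i, (X i).PosSemidef) {S : Matrix n n ℂ}
    (hS : S.PosSemidef) (hSX : S = ∑ i, X i) {f : ℝ → ℝ} (hf : ConcaveOn ℝ (Set.Ici 0) f)
    (hf0 : ∀ t, 0 ≤ t → 0 ≤ f t) {q : ℝ} (hq : 1 ≤ q) :
    ∑ j, f (hS.isHermitian.eigenvalues j) ^ q ≤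
      ∑ j, (∑ i, quadForm (cfc f (X i)) (hS.isHermitian.eigenvectorBasis j)) ^ q := by
  have hmono := hf.monotoneOn_of_nonneg hf0
  have h := sum_mul_concave_le hX hS hSX (V := fun t => f t ^ (q - 1)) hf (hf0 0 le_rfl)
    (fun x hx y hy hxy => Real.rpow_le_rpow (hf0 x hx) (hmono hx hy hxy) (by linarith))
    (fun t ht => Real.rpow_nonneg (hf0 t ht) _)
  set e := hS.isHermitian.eigenvectorBasis
  set x := hS.isHermitian.eigenvalues
  have hx : ∀ j, 0 ≤ f (x j) := fun j => hf0 _ (hS.eigenvalues_nonneg j)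
  have h1 : ∀ j, f (x j) ^ (q - 1) * f (x j) = f (x j) ^ q := by
    intro j
    rcases (hx j).eq_or_lt with h0 | h0
    · rw [← h0, mul_zero, Real.zero_rpow (by linarith)]
    · rw [Real.rpow_sub_one h0.ne', div_mul_cancel₀ _ h0.ne']
  simp_rw [h1] at h
  have h2 := Finset.sum_le_sum fun j (_ : j ∈ Finset.univ) =>
    Real.mul_rpow_sub_one_mul_le (t := ∑ i, quadForm (cfc f (X i)) (e j)) hq (hx j)
      (Finset.sum_nonneg fun i _ => (posSemidef_cfc (hX i) hf0).quadForm_nonneg _)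
  rw [← Finset.mul_sum, Finset.sum_add_distrib, ← Finset.mul_sum] at h2
  have h3 := mul_le_mul_of_nonneg_left h (by linarith : (0 : ℝ) ≤ q)
  linarith

/-- **Subadditivity** of concave functions in the Schatten `q`-norm. -/
theorem sum_concave_rpow_le (hX : ∀ i, (X i).PosSemidef) {S : Matrix n n ℂ}
    (hS : S.PosSemidef) (hSX : S = ∑ i, X i) {f : ℝ → ℝ} (hf : ConcaveOn ℝ (Set.Ici 0) f)
    (hf0 : ∀ t, 0 ≤ t → 0 ≤ f t) {T : Matrix n n ℂ} (hT : T.PosSemidef)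
    (hTX : T = ∑ i, cfc f (X i)) {q : ℝ} (hq : 1 ≤ q) :
    ∑ j, f (hS.isHermitian.eigenvalues j) ^ q ≤ ∑ j, hT.isHermitian.eigenvalues j ^ q := by
  refine (sum_rpow_le_sum_quadForm_cfc hX hS hSX hf hf0 hq).trans ?_
  simp_rw [← quadForm_sum, ← hTX]
  exact hT.sum_quadForm_rpow_le hq _

/-- A version of subadditivity that sees only the eigenvalues of the summands. -/
theorem sum_concave_rpow_le_card_rpow_mul (hX : ∀ i, (X i).PosSemidef) {S : Matrix n n ℂ}
    (hS : S.PosSemidef) (hSX : S = ∑ i, X i) {f : ℝ → ℝ} (hf : ConcaveOn ℝ (Set.Ici 0) f)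
    (hf0 : ∀ t, 0 ≤ t → 0 ≤ f t) {q : ℝ} (hq : 1 ≤ q) :
    ∑ j, f (hS.isHermitian.eigenvalues j) ^ q ≤
      (Fintype.card ι : ℝ) ^ (q - 1) * ∑ i, ∑ l, f ((hX i).isHermitian.eigenvalues l) ^ q := by
  refine (sum_rpow_le_sum_quadForm_cfc hX hS hSX hf hf0 hq).trans ?_
  have h1 : ∀ j, (∑ i, quadForm (cfc f (X i)) (hS.isHermitian.eigenvectorBasis j)) ^ q ≤
      (Fintype.card ι : ℝ) ^ (q - 1) *
        ∑ i, quadForm (cfc f (X i)) (hS.isHermitian.eigenvectorBasis j) ^ q := fun j =>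
    Real.rpow_sum_le_const_mul_sum_rpow_of_nonneg _ hq
      fun i _ => (posSemidef_cfc (hX i) hf0).quadForm_nonneg _
  refine (Finset.sum_le_sum fun j _ => h1 j).trans ?_
  rw [← Finset.mul_sum, Finset.sum_comm]
  refine mul_le_mul_of_nonneg_left (Finset.sum_le_sum fun i _ => ?_) (by positivity)
  refine ((posSemidef_cfc (hX i) hf0).sum_quadForm_rpow_le hq _).trans_eq ?_
  exact (hX i).isHermitian.sum_eigenvalues_cfc _ f rfl (fun t => t ^ q)

/-- **Superadditivity** of `Tr (·) ^ q`: this is the subadditivity of the concave function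
`t ↦ t ^ (1 / q)` applied to the matrices `f(X i) ^ q`. -/
theorem sum_sum_rpow_le (hX : ∀ i, (X i).PosSemidef) {f : ℝ → ℝ} (hf0 : ∀ t, 0 ≤ t → 0 ≤ f t)
    {T : Matrix n n ℂ} (hT : T.PosSemidef) (hTX : T = ∑ i, cfc f (X i)) {q : ℝ} (hq : 1 ≤ q) :
    ∑ i, ∑ l, f ((hX i).isHermitian.eigenvalues l) ^ q ≤
      ∑ j, hT.isHermitian.eigenvalues j ^ q := by
  have hq0 : 0 < q := by linarith
  have hfq : ∀ t, 0 ≤ t → 0 ≤ f t ^ q := fun t ht => Real.rpow_nonneg (hf0 t ht) q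
  have hY : ∀ i, (cfc (fun t => f t ^ q) (X i)).PosSemidef := fun i => posSemidef_cfc (hX i) hfq
  have hS : (∑ i, cfc (fun t => f t ^ q) (X i)).PosSemidef := posSemidef_sum _ fun i _ => hY i
  have hT' : T = ∑ i, cfc (fun t : ℝ => t ^ (1 / q)) (cfc (fun t => f t ^ q) (X i)) := by
    rw [hTX]
    refine Finset.sum_congr rfl fun i _ => ?_
    have hfin : (spectrum ℝ (X i)).Finite := finite_real_spectrum
    rw [← cfc_comp' (fun t : ℝ => t ^ (1 / q)) (fun t => f t ^ q) (X i)
      ((hfin.image _).continuousOn _) (hfin.continuousOn _) (hX i).isHermitian.isSelfAdjoint]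
    refine cfc_congr fun t ht => ?_
    rw [(hX i).isHermitian.spectrum_real_eq_range_eigenvalues] at ht
    obtain ⟨l, rfl⟩ := ht
    have := hf0 _ ((hX i).eigenvalues_nonneg l)
    rw [← Real.rpow_mul this, mul_one_div_cancel hq0.ne', Real.rpow_one]
  have h := sum_concave_rpow_le hY hS rfl
    (Real.concaveOn_rpow (p := 1 / q) (by positivity) (by rw [div_le_one hq0]; exact hq))
    (fun t ht => Real.rpow_nonneg ht _) hT hT' hq
  refine le_trans (le_of_eq ?_) h
  have h1 : ∀ j, (hS.isHermitian.eigenvalues j ^ (1 / q)) ^ q = hS.isHermitian.eigenvalues j := by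
    intro j
    rw [← Real.rpow_mul (hS.eigenvalues_nonneg j), one_div_mul_cancel hq0.ne', Real.rpow_one]
  simp_rw [h1]
  rw [← hS.isHermitian.sum_quadForm (EuclideanSpace.basisFun n ℂ)]
  simp_rw [quadForm_sum]
  rw [Finset.sum_comm (s := (Finset.univ : Finset n))]
  refine Finset.sum_congr rfl fun i _ => ?_
  rw [(hY i).isHermitian.sum_quadForm]
  exact ((hX i).isHermitian.sum_eigenvalues_cfc (hY i).isHermitian (fun t => f t ^ q) rfl
    fun t => t).symm

end Matrix

/-! ### Determinants, interlacing and log-majorization of block matrices -/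

/-- **Courant–Fischer comparison**: if `⟪x, A' x⟫ ≤ ⟪V x, A (V x)⟫` for an isometry `V`, where `A'`
and `A` are given by orthonormal eigenbases `e'`, `e` and decreasing eigenvalues `a'`, `a`, then
`a' j ≤ a j`. -/
theorem eigenvalue_le_of_quadratic_le {E F : Type*} [NormedAddCommGroup E] [InnerProductSpace ℂ E]
    [NormedAddCommGroup F] [InnerProductSpace ℂ F] {N k : ℕ} (e : OrthonormalBasis (Fin N) ℂ E)
    (e' : OrthonormalBasis (Fin k) ℂ F) {a : Fin N → ℝ} {a' : Fin k → ℝ} (ha : Antitone a)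
    (ha' : Antitone a') (V : F →ₗ[ℂ] E) (hV : ∀ x, ‖V x‖ = ‖x‖)
    (h : ∀ x, ∑ j, a' j * ‖inner ℂ (e' j) x‖ ^ 2 ≤ ∑ j, a j * ‖inner ℂ (e j) (V x)‖ ^ 2)
    (j : Fin k) (hj : (j : ℕ) < N) : a' j ≤ a ⟨j, hj⟩ := by
  -- a nonzero `x` in the span of `e' 0, …, e' j` with `V x` orthogonal to `e 0, …, e (j - 1)`
  let L : (Fin (j + 1) → ℂ) →ₗ[ℂ] F :=
    Fintype.linearCombination ℂ fun i : Fin (j + 1) => e' (Fin.castLE j.2 i)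
  let K : F →ₗ[ℂ] (Fin j → ℂ) :=
    LinearMap.pi fun i : Fin j => (innerₛₗ ℂ (e (Fin.castLE hj.le i))) ∘ₗ V
  have hker : LinearMap.ker (K ∘ₗ L) ≠ ⊥ := by
    apply LinearMap.ker_ne_bot_of_finrank_lt
    simp
  obtain ⟨c, hc, hc0⟩ := (Submodule.ne_bot_iff _).1 hker
  have hli : LinearIndependent ℂ (fun i : Fin (j + 1) => e' (Fin.castLE j.2 i)) :=
    e'.orthonormal.linearIndependent.comp _ (Fin.castLE_injective _)
  set x := L c with hx
  have hx0 : x ≠ 0 := by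
    intro h0
    exact hc0 (hli.fintypeLinearCombination_injective (by rw [map_zero]; exact h0))
  have hin' : ∀ i : Fin k, j < i → inner ℂ (e' i) x = 0 := by
    intro i hi
    rw [hx]
    simp only [L, Fintype.linearCombination_apply, inner_sum, inner_smul_right]
    refine Finset.sum_eq_zero fun l _ => ?_
    rw [e'.inner_eq_zero, mul_zero]
    intro hil
    have := congrArg Fin.val hil
    simp only [Fin.val_castLE] at this
    have := l.2
    have : (j : ℕ) < i := hi
    omega
  have hin : ∀ i : Fin N, (i : ℕ) < j → inner ℂ (e i) (V x) = 0 := by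
    intro i hi
    have := congrFun (LinearMap.mem_ker.1 hc) ⟨i, hi⟩
    simpa [K] using this
  have h1 : a' j * ‖x‖ ^ 2 ≤ ∑ i, a' i * ‖inner ℂ (e' i) x‖ ^ 2 := by
    rw [← e'.sum_sq_norm_inner_right x, Finset.mul_sum]
    refine Finset.sum_le_sum fun i _ => ?_
    rcases lt_or_ge j i with hji | hji
    · simp [hin' i hji]
    · exact mul_le_mul_of_nonneg_right (ha' hji) (sq_nonneg _)
  have h2 : ∑ i, a i * ‖inner ℂ (e i) (V x)‖ ^ 2 ≤ a ⟨j, hj⟩ * ‖x‖ ^ 2 := by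
    rw [← hV x, ← e.sum_sq_norm_inner_right (V x), Finset.mul_sum]
    refine Finset.sum_le_sum fun i _ => ?_
    rcases lt_or_ge (i : ℕ) j with hji | hji
    · simp [hin i hji]
    · exact mul_le_mul_of_nonneg_right (ha (Fin.mk_le_of_le_val hji)) (sq_nonneg _)
  exact le_of_mul_le_mul_right (h1.trans ((h x).trans h2)) (by positivity)

theorem exists_perm_antitone {n : ℕ} (a : Fin n → ℝ) : ∃ σ : Equiv.Perm (Fin n),
    Antitone (a ∘ σ) :=
  ⟨Tuple.sort (-a), fun i j hij => by
    have := Tuple.monotone_sort (-a) hij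
    simpa using this⟩

namespace Matrix

/-- Cauchy interlacing for determinants: `det` of a matrix dominated by a compression of `P` to
a `k`-dimensional space is at most the product of the `k` largest eigenvalues of `P`. -/
theorem prod_eigenvalues_le_of_compression {n k : ℕ} (hk : k ≤ n) {P : Matrix (Fin n) (Fin n) ℂ}
    (hP : P.IsHermitian) {P' : Matrix (Fin k) (Fin k) ℂ} (hP' : P'.PosSemidef)
    (V : EuclideanSpace ℂ (Fin k) →ₗ[ℂ] EuclideanSpace ℂ (Fin n)) (hV : ∀ x, ‖V x‖ = ‖x‖)
    (h : ∀ x, quadForm P' x ≤ quadForm P (V x)) {σ : Equiv.Perm (Fin n)}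
    (hσ : Antitone (hP.eigenvalues ∘ σ)) :
    ∏ j, hP'.isHermitian.eigenvalues j ≤ ∏ j : Fin k, hP.eigenvalues (σ (Fin.castLE hk j)) := by
  obtain ⟨τ, hτ⟩ := exists_perm_antitone hP'.isHermitian.eigenvalues
  rw [← Equiv.prod_comp τ]
  refine Finset.prod_le_prod (fun j _ => hP'.eigenvalues_nonneg _) fun j _ => ?_
  refine eigenvalue_le_of_quadratic_le (hP.eigenvectorBasis.reindex σ.symm)
    (hP'.isHermitian.eigenvectorBasis.reindex τ.symm) hσ hτ V hV (fun x => ?_) j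
    (j.2.trans_le hk)
  have := h x
  rw [hP'.isHermitian.quadForm_eq, hP.quadForm_eq, ← Equiv.sum_comp τ, ← Equiv.sum_comp σ] at this
  simpa using this

theorem PosSemidef.det_eq_prod_eigenvalues {k : ℕ} {P : Matrix (Fin k) (Fin k) ℂ} (hP : P.PosSemidef) :
    P.det = ((∏ j, hP.isHermitian.eigenvalues j : ℝ) : ℂ) := by
  rw [hP.isHermitian.det_eq_prod_eigenvalues]
  push_cast
  rfl

/-- The determinant is monotone on positive semidefinite matrices. -/
theorem PosSemidef.prod_eigenvalues_mono {k : ℕ} {D Q : Matrix (Fin k) (Fin k) ℂ}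
    (hD : D.PosSemidef) (hQ : Q.PosSemidef) (h : (Q - D).PosSemidef) :
    ∏ j, hD.isHermitian.eigenvalues j ≤ ∏ j, hQ.isHermitian.eigenvalues j := by
  obtain ⟨σ, hσ⟩ := exists_perm_antitone hQ.isHermitian.eigenvalues
  refine (prod_eigenvalues_le_of_compression le_rfl hQ.isHermitian hD LinearMap.id (fun _ => rfl) (fun x => ?_)
    hσ).trans_eq (Equiv.prod_comp σ _)
  have := h.quadForm_nonneg x
  simp only [quadForm, map_sub, LinearMap.sub_apply, inner_sub_right] at this
  simpa [quadForm] using this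

/-- For a positive semidefinite block matrix with off-diagonal block `S`,
`|det S|² ≤ det P * det Q`. -/
theorem sq_norm_det_le {k : ℕ} {P S Q : Matrix (Fin k) (Fin k) ℂ} (hP : P.PosSemidef)
    (hQ : Q.PosSemidef) (hF : (fromBlocks P S Sᴴ Q).PosSemidef) :
    ‖S.det‖ ^ 2 ≤ (∏ j, hP.isHermitian.eigenvalues j) * ∏ j, hQ.isHermitian.eigenvalues j := by
  have hP0 : 0 ≤ ∏ j, hP.isHermitian.eigenvalues j :=
    Finset.prod_nonneg fun j _ => hP.eigenvalues_nonneg j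
  have hQ0 : 0 ≤ ∏ j, hQ.isHermitian.eigenvalues j :=
    Finset.prod_nonneg fun j _ => hQ.eigenvalues_nonneg j
  rcases eq_or_ne S.det 0 with hS | hS
  · rw [hS]; simpa using mul_nonneg hP0 hQ0
  -- a kernel vector of `P` extends to one of the block matrix, so is killed by `Sᴴ`
  have hdet : P.det ≠ 0 := by
    intro h0
    obtain ⟨v, hv, hPv⟩ := exists_mulVec_eq_zero_iff.2 h0
    have h1 : fromBlocks P S Sᴴ Q *ᵥ Sum.elim v 0 = Sum.elim (P *ᵥ v) (Sᴴ *ᵥ v) := by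
      rw [fromBlocks_mulVec]; simp
    have h2 := (hF.dotProduct_mulVec_zero_iff (Sum.elim v 0)).1 (by
      rw [h1, hPv]
      simp [dotProduct])
    rw [h1] at h2
    have h3 : Sᴴ *ᵥ v = 0 := funext fun i => congrFun h2 (Sum.inr i)
    have h4 := exists_mulVec_eq_zero_iff.1 ⟨v, hv, h3⟩
    rw [det_conjTranspose] at h4
    exact hS (star_eq_zero.1 h4)
  have hPD : P.PosDef := hP.posDef_iff_det_ne_zero.2 hdet
  have hinv : Invertible P := invertibleOfIsUnitDet P (isUnit_iff_ne_zero.2 hdet)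
  have hschur := (hPD.fromBlocks₁₁ S Q).1 hF
  have hD : (Sᴴ * P⁻¹ * S).PosSemidef := hP.inv.conjTranspose_mul_mul_same S
  have hle := hD.prod_eigenvalues_mono hQ hschur
  have h5 : ‖S.det‖ ^ 2 =
      (∏ j, hP.isHermitian.eigenvalues j) * ∏ j, hD.isHermitian.eigenvalues j := by
    have h6 : P.det * (Sᴴ * P⁻¹ * S).det = star S.det * S.det := by
      rw [det_mul, det_mul, det_conjTranspose, det_nonsing_inv, Ring.inverse_eq_inv']
      field_simp
    rw [hP.det_eq_prod_eigenvalues, hD.det_eq_prod_eigenvalues, Complex.star_def, Complex.conj_mul'] at h6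
    exact_mod_cast h6.symm
  rw [h5]
  gcongr

theorem norm_toEuclideanLin_of_isometry {n k : ℕ} {W : Matrix (Fin n) (Fin k) ℂ}
    (hW : Wᴴ * W = 1) (x : EuclideanSpace ℂ (Fin k)) : ‖toEuclideanLin W x‖ = ‖x‖ := by
  have h : inner ℂ (toEuclideanLin W x) (toEuclideanLin W x) = inner ℂ x x := by
    rw [← LinearMap.adjoint_inner_right, ← toEuclideanLin_conjTranspose_eq_adjoint]
    congr 1
    simp [toLpLin_apply, hW]
  rw [@norm_eq_sqrt_re_inner ℂ, h, ← @norm_eq_sqrt_re_inner ℂ]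

theorem quadForm_conj {n k : ℕ} (W : Matrix (Fin n) (Fin k) ℂ) (P : Matrix (Fin n) (Fin n) ℂ)
    (x : EuclideanSpace ℂ (Fin k)) :
    quadForm (Wᴴ * P * W) x = quadForm P (toEuclideanLin W x) := by
  rw [quadForm, quadForm, ← LinearMap.adjoint_inner_right,
    ← toEuclideanLin_conjTranspose_eq_adjoint]
  congr 2
  simp [toLpLin_apply, Matrix.mul_assoc]

/-- **Log-majorization**: if the block matrix with diagonal blocks `P`, `Q` and off-diagonal
block `M` is positive semidefinite, and `H = |M|`, then the product of the `k` largest squared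
eigenvalues of `H` is at most that of the `k` largest eigenvalues of `P` times the same for `Q`. -/
theorem prod_sq_eigenvalues_le {n k : ℕ} (hk : k ≤ n) {P M Q H : Matrix (Fin n) (Fin n) ℂ}
    (hP : P.PosSemidef) (hQ : Q.PosSemidef) (hH : H.PosSemidef) (hHM : Mᴴ * M = H * H)
    (hF : (fromBlocks P M Mᴴ Q).PosSemidef) {σ ρ τ : Equiv.Perm (Fin n)}
    (hσ : Antitone (hP.isHermitian.eigenvalues ∘ σ))
    (hρ : Antitone (hQ.isHermitian.eigenvalues ∘ ρ)) :
    ∏ j : Fin k, hH.isHermitian.eigenvalues (τ (Fin.castLE hk j)) ^ 2 ≤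
      (∏ j : Fin k, hP.isHermitian.eigenvalues (σ (Fin.castLE hk j))) *
        ∏ j : Fin k, hQ.isHermitian.eigenvalues (ρ (Fin.castLE hk j)) := by
  set s : Fin k → ℝ := fun j => hH.isHermitian.eigenvalues (τ (Fin.castLE hk j)) with hs
  have hP0 : 0 ≤ ∏ j : Fin k, hP.isHermitian.eigenvalues (σ (Fin.castLE hk j)) :=
    Finset.prod_nonneg fun j _ => hP.eigenvalues_nonneg _
  have hQ0 : 0 ≤ ∏ j : Fin k, hQ.isHermitian.eigenvalues (ρ (Fin.castLE hk j)) :=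
    Finset.prod_nonneg fun j _ => hQ.eigenvalues_nonneg _
  by_cases h0 : ∃ j, s j = 0
  · obtain ⟨j, hj⟩ := h0
    rw [Finset.prod_eq_zero (Finset.mem_univ j) (show s j ^ 2 = 0 by rw [hj]; simp)]
    positivity
  push Not at h0
  -- the right and left singular vectors of `M`
  let W₂ : Matrix (Fin n) (Fin k) ℂ :=
    of fun i j => hH.isHermitian.eigenvectorBasis (τ (Fin.castLE hk j)) i
  let D : Matrix (Fin k) (Fin k) ℂ := diagonal fun j => (s j : ℂ)
  let D' : Matrix (Fin k) (Fin k) ℂ := diagonal fun j => ((s j)⁻¹ : ℂ)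
  let W₁ : Matrix (Fin n) (Fin k) ℂ := M * W₂ * D'
  have hDD' : D' * D = 1 := by
    rw [diagonal_mul_diagonal, ← diagonal_one]
    congr 1
    ext j
    exact inv_mul_cancel₀ (by exact_mod_cast h0 j)
  have hDD'' : D * D' = 1 := by
    rw [diagonal_mul_diagonal, ← diagonal_one]
    congr 1
    ext j
    exact mul_inv_cancel₀ (by exact_mod_cast h0 j)
  have hD'h : D'ᴴ = D' := by
    simp only [D', diagonal_conjTranspose]
    congr 1
    ext j
    simp
  have hHW : H * W₂ = W₂ * D := by
    ext i j
    have := congrFun (hH.isHermitian.mulVec_eigenvectorBasis (τ (Fin.castLE hk j))) i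
    simp only [D, mul_diagonal]
    rw [mul_apply]
    simp only [W₂, of_apply]
    rw [mulVec, dotProduct] at this
    rw [this]
    simp [hs, mul_comm]
  have hW₂ : W₂ᴴ * W₂ = 1 := by
    ext i j
    rw [mul_apply]
    have h := hH.isHermitian.eigenvectorBasis.inner_eq_ite (τ (Fin.castLE hk i))
      (τ (Fin.castLE hk j))
    rw [PiLp.inner_apply] at h
    simp only [RCLike.inner_apply, EmbeddingLike.apply_eq_iff_eq, Fin.castLE_inj] at h
    rw [one_apply, ← h]
    refine Finset.sum_congr rfl fun l _ => ?_
    simp [W₂, mul_comm]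
  have hMM : W₂ᴴ * (Mᴴ * (M * W₂)) = D * D := by
    rw [← Matrix.mul_assoc Mᴴ, hHM, Matrix.mul_assoc, hHW, ← Matrix.mul_assoc H, hHW,
      ← Matrix.mul_assoc, ← Matrix.mul_assoc, hW₂, Matrix.one_mul]
  have hW₁M : W₁ᴴ * M * W₂ = D := by
    simp only [W₁, conjTranspose_mul, hD'h, Matrix.mul_assoc]
    rw [hMM, ← Matrix.mul_assoc, hDD', Matrix.one_mul]
  have hW₁ : W₁ᴴ * W₁ = 1 := by
    have : W₁ᴴ * W₁ = W₁ᴴ * M * W₂ * D' := by simp only [W₁, Matrix.mul_assoc]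
    rw [this, hW₁M, hDD'']
  have hblock : (fromBlocks (W₁ᴴ * P * W₁) D Dᴴ (W₂ᴴ * Q * W₂)).PosSemidef := by
    have := hF.conjTranspose_mul_mul_same (fromBlocks W₁ 0 0 W₂)
    rw [fromBlocks_conjTranspose, fromBlocks_multiply, fromBlocks_multiply] at this
    simp only [conjTranspose_zero, Matrix.zero_mul, Matrix.mul_zero, add_zero, zero_add] at this
    have h2 : W₂ᴴ * Mᴴ * W₁ = Dᴴ := by
      rw [← hW₁M]; simp [conjTranspose_mul, Matrix.mul_assoc]
    rwa [hW₁M, h2] at this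
  have hP' := hP.conjTranspose_mul_mul_same W₁
  have hQ' := hQ.conjTranspose_mul_mul_same W₂
  have key := sq_norm_det_le hP' hQ' hblock
  have hdet : ‖D.det‖ ^ 2 = ∏ j, s j ^ 2 := by
    simp only [D, det_diagonal, norm_prod, Complex.norm_real, Real.norm_eq_abs]
    rw [← Finset.abs_prod, sq_abs, Finset.prod_pow]
  rw [hdet] at key
  refine key.trans (mul_le_mul ?_ ?_ (Finset.prod_nonneg fun j _ => hQ'.eigenvalues_nonneg _) hP0)
  · exact prod_eigenvalues_le_of_compression hk hP.isHermitian hP' (toEuclideanLin W₁)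
      (norm_toEuclideanLin_of_isometry hW₁) (fun x => (quadForm_conj W₁ P x).le) hσ
  · exact prod_eigenvalues_le_of_compression hk hQ.isHermitian hQ' (toEuclideanLin W₂)
      (norm_toEuclideanLin_of_isometry hW₂) (fun x => (quadForm_conj W₂ Q x).le) hρ

end Matrix

/-! ### From log-majorization to geometrically convex functions -/

/-- A continuous midpoint convex function that is nonpositive at the ends of `[0, 1]` is nonpositive
in between: a positive maximum cannot be attained at a last point. -/
theorem nonpos_of_midpoint_convex {g : ℝ → ℝ} (hg : Continuous g)
    (hmid : ∀ x y, g ((x + y) / 2) ≤ (g x + g y) / 2) (h0 : g 0 ≤ 0) (h1 : g 1 ≤ 0) {t : ℝ}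
    (ht : t ∈ Set.Icc (0 : ℝ) 1) : g t ≤ 0 := by
  obtain ⟨c₀, hc₀, hmax⟩ := isCompact_Icc.exists_isMaxOn ⟨t, ht⟩ hg.continuousOn
  refine (hmax ht).trans ?_
  by_contra! hM
  obtain ⟨c, ⟨hc, hcM⟩, hlast⟩ := (isCompact_Icc.inter_right
    (isClosed_singleton.preimage hg : IsClosed (g ⁻¹' {g c₀}))).exists_isGreatest
      ⟨c₀, hc₀, rfl⟩
  have hcM : g c = g c₀ := hcM
  have hc0 : 0 < c := lt_of_le_of_ne hc.1 (by rintro rfl; linarith)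
  have hc1 : c < 1 := lt_of_le_of_ne hc.2 (by rintro rfl; linarith)
  set d := min c (1 - c) with hd
  have hd0 : 0 < d := lt_min hc0 (by linarith)
  have hdc : d ≤ c := min_le_left _ _
  have hdc' : d ≤ 1 - c := min_le_right _ _
  have hr : c + d ∈ Set.Icc (0 : ℝ) 1 := ⟨by linarith, by linarith⟩
  have hl : c - d ∈ Set.Icc (0 : ℝ) 1 := ⟨by linarith, by linarith⟩
  have h2 : g (c + d) < g c₀ := by
    refine lt_of_le_of_ne (hmax hr) fun h => ?_
    have := hlast ⟨hr, h⟩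
    linarith
  have h3 : g (c - d) ≤ g c₀ := hmax hl
  have h4 := hmid (c - d) (c + d)
  rw [show (c - d + (c + d)) / 2 = c by ring, hcM] at h4
  linarith

theorem convexOn_of_continuous_of_midpoint {ψ : ℝ → ℝ} (hψ : Continuous ψ)
    (hmid : ∀ x y, ψ ((x + y) / 2) ≤ (ψ x + ψ y) / 2) : ConvexOn ℝ Set.univ ψ := by
  refine ⟨convex_univ, fun x _ y _ a b ha hb hab => ?_⟩
  have h := nonpos_of_midpoint_convex
    (g := fun t => ψ (x + t * (y - x)) - (ψ x + t * (ψ y - ψ x))) (by fun_prop)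
    (fun u v => by
      have := hmid (x + u * (y - x)) (x + v * (y - x))
      rw [show (x + u * (y - x) + (x + v * (y - x))) / 2 = x + (u + v) / 2 * (y - x) by ring]
        at this
      linarith) (by simp) (by simp) (t := b) ⟨hb, by linarith⟩
  obtain rfl : a = 1 - b := by linarith
  simp only [smul_eq_mul]
  rw [show (1 - b) * x + b * y = x + b * (y - x) by ring]
  linarith

/-- Abel summation: a decreasing nonnegative weight preserves nonnegativity of partial sums. -/
theorem sum_mul_nonneg_of_partial_sums {n : ℕ} {c d : ℕ → ℝ}
    (hc : ∀ j, j + 1 < n → c (j + 1) ≤ c j) (hc0 : ∀ j, j < n → 0 ≤ c j)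
    (hd : ∀ k, k ≤ n → 0 ≤ ∑ j ∈ Finset.range k, d j) :
    0 ≤ ∑ j ∈ Finset.range n, c j * d j := by
  have key : ∀ k, k < n → c k * ∑ j ∈ Finset.range (k + 1), d j ≤
      ∑ j ∈ Finset.range (k + 1), c j * d j := by
    intro k
    induction k with
    | zero => simp
    | succ k ih =>
      intro hk
      have h1 := ih (by omega)
      have h2 := mul_le_mul_of_nonneg_right (hc k hk) (hd (k + 1) (by omega))
      rw [Finset.sum_range_succ _ (k + 1), Finset.sum_range_succ _ (k + 1), mul_add]
      linarith
  rcases n with _ | n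
  · simp
  · exact (mul_nonneg (hc0 n (by omega)) (hd (n + 1) le_rfl)).trans (key n (by omega))

/-- Weak log-majorization implies weak majorization under a monotone `φ` with `φ ∘ exp` convex. -/
theorem sum_le_sum_of_prod_le_prod {φ : ℝ → ℝ} (hφ : MonotoneOn φ (Set.Ici 0))
    (hconv : ConvexOn ℝ Set.univ fun x => φ (Real.exp x)) {s t : ℕ → ℝ} (hs0 : ∀ j, 0 ≤ s j)
    (ht0 : ∀ j, 0 ≤ t j) {n : ℕ} (hs : ∀ i j, i ≤ j → j < n → s j ≤ s i)
    (hprod : ∀ k, k ≤ n → ∏ j ∈ Finset.range k, s j ≤ ∏ j ∈ Finset.range k, t j) :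
    ∑ j ∈ Finset.range n, φ (s j) ≤ ∑ j ∈ Finset.range n, φ (t j) := by
  induction n with
  | zero => simp
  | succ n ih =>
    rcases (hs0 n).eq_or_lt with h0 | h0
    · -- a vanishing last entry is handled by monotonicity alone
      rw [Finset.sum_range_succ, Finset.sum_range_succ]
      refine add_le_add (ih (fun i j hij hj => hs i j hij (by omega))
        fun k hk => hprod k (by omega)) ?_
      exact hφ (hs0 n) (ht0 n) (by rw [← h0]; exact ht0 n)
    have hspos : ∀ j, j < n + 1 → 0 < s j := fun j hj =>
      h0.trans_le (hs j n (by omega) (by omega))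
    have htpos : ∀ j, j < n + 1 → 0 < t j := by
      intro j hj
      refine lt_of_le_of_ne (ht0 j) fun h => ?_
      have h1 := hprod (n + 1) le_rfl
      rw [Finset.prod_eq_zero (i := j) (f := t) (Finset.mem_range.2 hj) h.symm] at h1
      exact absurd h1 (not_le.2 (Finset.prod_pos fun j hj => hspos j (Finset.mem_range.1 hj)))
    set ψ : ℝ → ℝ := fun x => φ (Real.exp x) with hψ
    set c : ℕ → ℝ := fun j => derivWithin ψ (Set.Ioi (Real.log (s j))) (Real.log (s j)) with hc
    have hmono : Monotone ψ := fun x y hxy =>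
      hφ (Real.exp_pos _).le (Real.exp_pos _).le (Real.exp_le_exp.2 hxy)
    have hψlog : ∀ x, 0 < x → ψ (Real.log x) = φ x := fun x hx => by simp [hψ, Real.exp_log hx]
    have htan : ∀ j, j < n + 1 →
        c j * (Real.log (t j) - Real.log (s j)) ≤ φ (t j) - φ (s j) := by
      intro j hj
      have := hconv.add_rightDeriv_mul_le (x := Real.log (s j)) (y := Real.log (t j))
        (by simp) (Set.mem_univ _)
      rw [hψlog _ (hspos j hj), hψlog _ (htpos j hj)] at this
      linarith
    have habel : 0 ≤ ∑ j ∈ Finset.range (n + 1), c j * (Real.log (t j) - Real.log (s j)) := by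
      refine sum_mul_nonneg_of_partial_sums (fun j hj => ?_) (fun j hj => ?_) fun k hk => ?_
      · have := hconv.monotoneOn_rightDeriv
        rw [interior_univ] at this
        exact this (Set.mem_univ _) (Set.mem_univ _)
          (Real.log_le_log (hspos _ hj) (hs _ _ (by omega) hj))
      · exact hmono.monotoneOn _ |>.derivWithin_nonneg
      · rw [Finset.sum_sub_distrib,
          ← Real.log_prod fun j hj => (htpos j ((Finset.mem_range.1 hj).trans_le hk)).ne',
          ← Real.log_prod fun j hj => (hspos j ((Finset.mem_range.1 hj).trans_le hk)).ne',
          sub_nonneg]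
        exact Real.log_le_log (Finset.prod_pos fun j hj =>
          hspos j ((Finset.mem_range.1 hj).trans_le hk)) (hprod k hk)
    have := Finset.sum_le_sum fun j (hj : j ∈ Finset.range (n + 1)) =>
      htan j (Finset.mem_range.1 hj)
    rw [Finset.sum_sub_distrib] at this
    linarith

/-- Geometric convexity passes to `f ^ q`. It extends to arguments that vanish because `f` is
monotone. -/
theorem GeometricallyConvex.rpow_sqrt_mul_le {f : ℝ → ℝ} (hg : GeometricallyConvex f)
    (hf0 : ∀ t : ℝ, 0 ≤ t → 0 ≤ f t) (hf : ConcaveOn ℝ (Set.Ici 0) f)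
    {q a b : ℝ} (hq : 1 ≤ q) (ha : 0 ≤ a) (hb : 0 ≤ b) :
    f √(a * b) ^ q ≤ √(f a ^ q) * √(f b ^ q) := by
  have hmono := hf.monotoneOn_of_nonneg hf0
  have h : f √(a * b) ≤ √(f a * f b) := by
    rcases ha.eq_or_lt with rfl | ha'
    · rw [zero_mul, Real.sqrt_zero]
      exact Real.le_sqrt_of_sq_le (by
        rw [sq]; exact mul_le_mul_of_nonneg_left (hmono ha hb hb) (hf0 0 ha))
    rcases hb.eq_or_lt with rfl | hb'
    · rw [mul_zero, Real.sqrt_zero]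
      exact Real.le_sqrt_of_sq_le (by
        rw [sq]; exact mul_le_mul_of_nonneg_right (hmono hb ha ha) (hf0 0 hb))
    exact hg a b ha' hb'
  refine (Real.rpow_le_rpow (hf0 _ (Real.sqrt_nonneg _)) h (by linarith)).trans_eq ?_
  rw [← Real.sqrt_mul (Real.rpow_nonneg (hf0 a ha) q), ← Real.mul_rpow (hf0 a ha) (hf0 b hb),
    Real.sqrt_eq_rpow, Real.sqrt_eq_rpow, ← Real.rpow_mul (mul_nonneg (hf0 a ha) (hf0 b hb)),
    ← Real.rpow_mul (mul_nonneg (hf0 a ha) (hf0 b hb)), mul_comm q]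

/-- Geometric convexity of `f ^ q` is midpoint convexity in logarithmic coordinates, up to the
inequality of arithmetic and geometric means; continuity comes from concavity. -/
theorem GeometricallyConvex.convexOn_rpow_exp {f : ℝ → ℝ} (hg : GeometricallyConvex f)
    (hf0 : ∀ t : ℝ, 0 ≤ t → 0 ≤ f t) (hf : ConcaveOn ℝ (Set.Ici 0) f)
    {q : ℝ} (hq : 1 ≤ q) :
    ConvexOn ℝ Set.univ fun x => f (Real.exp x) ^ q := by
  refine convexOn_of_continuous_of_midpoint ?_ fun x y => ?_
  · have h1 : ContinuousOn f (Set.Ioi 0) := by simpa using hf.continuousOn_interior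
    have h2 : Continuous fun x => f (Real.exp x) :=
      h1.comp_continuous Real.continuous_exp fun x => Real.exp_pos x
    exact h2.rpow_const fun x => Or.inr (by linarith)
  · have h1 := hg.rpow_sqrt_mul_le hf0 hf hq (Real.exp_pos x).le (Real.exp_pos y).le
    rw [← Real.exp_add, ← Real.exp_half] at h1
    refine h1.trans ?_
    have h3 := Real.sq_sqrt (Real.rpow_nonneg (hf0 _ (Real.exp_pos x).le) q)
    have h4 := Real.sq_sqrt (Real.rpow_nonneg (hf0 _ (Real.exp_pos y).le) q)
    nlinarith [sq_nonneg (√(f (Real.exp x) ^ q) - √(f (Real.exp y) ^ q))]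

/-- If `s` is log-majorized by `√(a j * b j)`, then `∑ f(s)^q` is at most the geometric mean of
`∑ f(a)^q` and `∑ f(b)^q`. -/
theorem GeometricallyConvex.sq_sum_rpow_le {f : ℝ → ℝ} (hg : GeometricallyConvex f)
    (hf0 : ∀ t : ℝ, 0 ≤ t → 0 ≤ f t) (hf : ConcaveOn ℝ (Set.Ici 0) f)
    {q : ℝ} (hq : 1 ≤ q) {n : ℕ} {s a b : Fin n → ℝ}
    (hs0 : ∀ j, 0 ≤ s j) (ha0 : ∀ j, 0 ≤ a j) (hb0 : ∀ j, 0 ≤ b j) (hs : Antitone s)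
    (hprod : ∀ k (hk : k ≤ n), ∏ j : Fin k, s (Fin.castLE hk j) ^ 2 ≤
      (∏ j : Fin k, a (Fin.castLE hk j)) * ∏ j : Fin k, b (Fin.castLE hk j)) :
    (∑ j, f (s j) ^ q) ^ 2 ≤ (∑ j, f (a j) ^ q) * ∑ j, f (b j) ^ q := by
  have hmono := hf.monotoneOn_of_nonneg hf0
  have hpos : ∀ x, 0 ≤ x → 0 ≤ f x ^ q := fun x hx => Real.rpow_nonneg (hf0 x hx) q
  have h1 : ∑ j, f (s j) ^ q ≤ ∑ j, f √(a j * b j) ^ q := by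
    -- extension by zero to a sequence indexed by `ℕ`
    let ext (u : Fin n → ℝ) (j : ℕ) : ℝ := if h : j < n then u ⟨j, h⟩ else 0
    have hext : ∀ (u : Fin n → ℝ) (j : Fin n), ext u j = u j := fun u j => by simp [ext]
    have hext0 : ∀ u : Fin n → ℝ, (∀ j, 0 ≤ u j) → ∀ j, 0 ≤ ext u j := by
      intro u hu j
      simp only [ext]
      split_ifs
      exacts [hu _, le_rfl]
    have := sum_le_sum_of_prod_le_prod (φ := fun x => f x ^ q)
      (fun x hx y hy hxy => Real.rpow_le_rpow (hf0 x hx) (hmono hx hy hxy) (by linarith))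
      (hg.convexOn_rpow_exp hf0 hf hq) (hext0 s hs0)
      (hext0 (fun j => √(a j * b j)) fun j => Real.sqrt_nonneg _) (n := n)
      (fun i j hij hj => by
        simpa [ext, hj, hij.trans_lt hj] using! hs (Fin.mk_le_mk.2 hij))
      (fun k hk => by
        have hext' : ∀ (u : Fin n → ℝ) (j : Fin k), ext u j = u (Fin.castLE hk j) :=
          fun u j => hext u (Fin.castLE hk j)
        simp_rw [← Fin.prod_univ_eq_prod_range, hext']
        refine le_of_sq_le_sq ?_ (Finset.prod_nonneg fun j _ => Real.sqrt_nonneg _)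
        rw [← Finset.prod_pow, ← Finset.prod_pow]
        refine (hprod k hk).trans_eq ?_
        rw [← Finset.prod_mul_distrib]
        exact Finset.prod_congr rfl fun j _ =>
          (Real.sq_sqrt (mul_nonneg (ha0 _) (hb0 _))).symm)
    simpa [← Fin.sum_univ_eq_sum_range (fun j => f (ext _ j) ^ q), hext] using! this
  have h2 : ∑ j, f (s j) ^ q ≤ ∑ j, √(f (a j) ^ q) * √(f (b j) ^ q) :=
    h1.trans (Finset.sum_le_sum fun j _ => hg.rpow_sqrt_mul_le hf0 hf hq (ha0 j) (hb0 j))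
  calc (∑ j, f (s j) ^ q) ^ 2 ≤ (∑ j, √(f (a j) ^ q) * √(f (b j) ^ q)) ^ 2 :=
        pow_le_pow_left₀ (Finset.sum_nonneg fun j _ => hpos _ (hs0 j)) h2 2
    _ ≤ (∑ j, √(f (a j) ^ q) ^ 2) * ∑ j, √(f (b j) ^ q) ^ 2 :=
        Finset.sum_mul_sq_le_sq_mul_sq _ _ _
    _ = _ := by
        simp_rw [Real.sq_sqrt (hpos _ (ha0 _)), Real.sq_sqrt (hpos _ (hb0 _))]

/-! ### The block matrix of absolute values and the norm inequality -/

namespace Matrix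

variable {n : ℕ}

/-- The positive semidefinite matrix `A |A|⁻¹ A*`, with the pseudo-inverse of `|A|`. It equals
`|A*|`, but only its being a diagonal block next to `|A|` and its spectrum are needed. -/
noncomputable def leftAbs (A : Matrix (Fin n) (Fin n) ℂ) : Matrix (Fin n) (Fin n) ℂ :=
  A * cfc (fun x : ℝ => x⁻¹) (CFC.abs A) * Aᴴ

theorem posSemidef_abs (A : Matrix (Fin n) (Fin n) ℂ) : (CFC.abs A).PosSemidef :=
  nonneg_iff_posSemidef.1 (CFC.abs_nonneg A)

theorem conjTranspose_mul_self_eq_abs_mul_abs (A : Matrix (Fin n) (Fin n) ℂ) :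
    Aᴴ * A = CFC.abs A * CFC.abs A :=
  (CFC.abs_mul_abs A).symm

theorem PosSemidef.cfc_inv {H : Matrix (Fin n) (Fin n) ℂ} (hH : H.PosSemidef) :
    (cfc (fun x : ℝ => x⁻¹) H).PosSemidef :=
  posSemidef_cfc hH fun _ ht => inv_nonneg.2 ht

theorem IsHermitian.cfc_mul_self {H : Matrix (Fin n) (Fin n) ℂ} (hH : H.IsHermitian) (g : ℝ → ℝ) :
    cfc g H * H = cfc (fun x => g x * x) H := by
  have hfin : (spectrum ℝ H).Finite := finite_real_spectrum
  rw [cfc_mul g (fun x => x) H (hfin.continuousOn _) (hfin.continuousOn _),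
    cfc_id' ℝ H hH.isSelfAdjoint]

/-- The function `x⁻¹` with `0⁻¹ = 0` gives the Moore–Penrose pseudo-inverse. -/
theorem IsHermitian.cfc_inv_mul_self_mul_self {H : Matrix (Fin n) (Fin n) ℂ}
    (hH : H.IsHermitian) : cfc (fun x : ℝ => x⁻¹) H * H * H = H := by
  rw [hH.cfc_mul_self, hH.cfc_mul_self]
  conv_rhs => rw [← cfc_id' ℝ H hH.isSelfAdjoint]
  refine cfc_congr fun x _ => ?_
  rcases eq_or_ne x 0 with rfl | h
  · simp
  · simp [h]

theorem IsHermitian.mul_cfc_inv_mul_self {H : Matrix (Fin n) (Fin n) ℂ} (hH : H.IsHermitian) :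
    H * cfc (fun x : ℝ => x⁻¹) H * H = H := by
  have hc := (cfc_commute_cfc id (fun x : ℝ => x⁻¹) H).eq
  rw [cfc_id ℝ H hH.isSelfAdjoint] at hc
  rw [hc, hH.cfc_inv_mul_self_mul_self]

/-- `|A|⁻¹ |A|` is the projection onto the orthogonal complement of `ker |A| = ker A`. -/
theorem mul_cfc_inv_abs_mul_abs (A : Matrix (Fin n) (Fin n) ℂ) :
    A * cfc (fun x : ℝ => x⁻¹) (CFC.abs A) * CFC.abs A = A := by
  have hH := (posSemidef_abs A).isHermitian
  set H := CFC.abs A with hHdef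
  set Y := cfc (fun x : ℝ => x⁻¹) H with hY
  have hHYH : H * (Y * H) = H := by rw [← Matrix.mul_assoc, hH.mul_cfc_inv_mul_self]
  -- `A (Y H - 1)` vanishes since its square does
  have h0 : (A * (Y * H - 1))ᴴ * (A * (Y * H - 1)) = 0 := by
    rw [conjTranspose_mul, Matrix.mul_assoc, ← Matrix.mul_assoc Aᴴ,
      conjTranspose_mul_self_eq_abs_mul_abs, ← hHdef, Matrix.mul_assoc H, Matrix.mul_sub H (Y * H),
      hHYH, Matrix.mul_one, sub_self, Matrix.mul_zero, Matrix.mul_zero]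
  have h1 := conjTranspose_mul_self_eq_zero.1 h0
  rw [Matrix.mul_sub, Matrix.mul_one, sub_eq_zero, ← Matrix.mul_assoc] at h1
  exact h1

theorem posSemidef_leftAbs (A : Matrix (Fin n) (Fin n) ℂ) : (leftAbs A).PosSemidef :=
  (posSemidef_abs A).cfc_inv.mul_mul_conjTranspose_same A

/-- `leftAbs A` and `|A|` have the same eigenvalues, because `X Y` and `Y X` have the same
characteristic polynomial. -/
theorem eigenvalues_leftAbs (A : Matrix (Fin n) (Fin n) ℂ) :
    (posSemidef_leftAbs A).isHermitian.eigenvalues = (posSemidef_abs A).isHermitian.eigenvalues := by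
  rw [IsHermitian.eigenvalues_eq_eigenvalues_iff, leftAbs, Matrix.mul_assoc, charpoly_mul_comm,
    Matrix.mul_assoc, conjTranspose_mul_self_eq_abs_mul_abs, ← Matrix.mul_assoc,
    (posSemidef_abs A).isHermitian.cfc_inv_mul_self_mul_self]

/-- With `Y` the pseudo-inverse of `|A|`, the block matrix is `G* |A| G` for `G = [Y A*, Y |A|]`. -/
theorem posSemidef_fromBlocks_leftAbs_abs (A : Matrix (Fin n) (Fin n) ℂ) :
    (fromBlocks (leftAbs A) A Aᴴ (CFC.abs A)).PosSemidef := by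
  have hA := mul_cfc_inv_abs_mul_abs A
  have hH := (posSemidef_abs A).isHermitian
  have h := (posSemidef_abs A).conjTranspose_mul_mul_same
    (fromCols (cfc (fun x : ℝ => x⁻¹) (CFC.abs A) * Aᴴ)
      (cfc (fun x : ℝ => x⁻¹) (CFC.abs A) * CFC.abs A))
  rw [conjTranspose_fromCols_eq_fromRows_conjTranspose, fromRows_mul, fromRows_mul_fromCols,
    conjTranspose_mul, conjTranspose_mul, conjTranspose_conjTranspose, hH.eq] at h
  have hYh : (cfc (fun x : ℝ => x⁻¹) (CFC.abs A))ᴴ = cfc (fun x : ℝ => x⁻¹) (CFC.abs A) :=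
    isHermitian_cfc _
  rw [hYh] at h
  set H := CFC.abs A with hHdef
  set Y := cfc (fun x : ℝ => x⁻¹) H with hY
  have hHYH : H * Y * H = H := hH.mul_cfc_inv_mul_self
  have hAh : H * Y * Aᴴ = Aᴴ := by
    have := congrArg conjTranspose hA
    rwa [conjTranspose_mul, conjTranspose_mul, hH.eq, hYh, ← Matrix.mul_assoc] at this
  have e1 : A * Y * H * (Y * Aᴴ) = leftAbs A := by
    rw [hA, leftAbs, ← Matrix.mul_assoc]
  have e2 : A * Y * H * (Y * H) = A := by rw [hA, ← Matrix.mul_assoc, hA]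
  have e3 : H * Y * H * (Y * Aᴴ) = Aᴴ := by rw [hHYH, ← Matrix.mul_assoc, hAh]
  have e4 : H * Y * H * (Y * H) = H := by rw [hHYH, ← Matrix.mul_assoc, hHYH]
  rwa [e1, e2, e3, e4] at h

theorem fromBlocks_sum {ι : Type*} (s : Finset ι) (P M N Q : ι → Matrix (Fin n) (Fin n) ℂ) :
    ∑ i ∈ s, fromBlocks (P i) (M i) (N i) (Q i) =
      fromBlocks (∑ i ∈ s, P i) (∑ i ∈ s, M i) (∑ i ∈ s, N i) (∑ i ∈ s, Q i) := by
  ext a b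
  rcases a with a | a <;> rcases b with b | b <;> simp [Matrix.sum_apply]

/-- For a positive semidefinite block matrix with diagonal blocks `P`, `Q` and off-diagonal block
`M`, the quantity `Tr f(|M|)^q` is at most the geometric mean of `Tr f(P)^q` and `Tr f(Q)^q`. -/
theorem sq_sum_rpow_abs_le {P M Q : Matrix (Fin n) (Fin n) ℂ} (hP : P.PosSemidef)
    (hQ : Q.PosSemidef) (hF : (fromBlocks P M Mᴴ Q).PosSemidef) {f : ℝ → ℝ}
    (hg : GeometricallyConvex f) (hf0 : ∀ t : ℝ, 0 ≤ t → 0 ≤ f t)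
    (hf : ConcaveOn ℝ (Set.Ici 0) f) {q : ℝ} (hq : 1 ≤ q) :
    (∑ j, f ((posSemidef_abs M).isHermitian.eigenvalues j) ^ q) ^ 2 ≤
      (∑ j, f (hP.isHermitian.eigenvalues j) ^ q) *
        ∑ j, f (hQ.isHermitian.eigenvalues j) ^ q := by
  obtain ⟨σ, hσ⟩ := exists_perm_antitone hP.isHermitian.eigenvalues
  obtain ⟨ρ, hρ⟩ := exists_perm_antitone hQ.isHermitian.eigenvalues
  obtain ⟨τ, hτ⟩ := exists_perm_antitone (posSemidef_abs M).isHermitian.eigenvalues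
  have := hg.sq_sum_rpow_le hf0 hf hq (fun j => (posSemidef_abs M).eigenvalues_nonneg (τ j))
    (fun j => hP.eigenvalues_nonneg (σ j)) (fun j => hQ.eigenvalues_nonneg (ρ j)) hτ
    fun k hk => prod_sq_eigenvalues_le hk hP hQ (posSemidef_abs M)
      (conjTranspose_mul_self_eq_abs_mul_abs M) hF hσ hρ
  rwa [Equiv.sum_comp τ fun j => f ((posSemidef_abs M).isHermitian.eigenvalues j) ^ q,
    Equiv.sum_comp σ fun j => f (hP.isHermitian.eigenvalues j) ^ q,
    Equiv.sum_comp ρ fun j => f (hQ.isHermitian.eigenvalues j) ^ q] at this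

/-- The norm inequality for finite `q`, squared and raised to the power `q`. -/
theorem sq_sum_rpow_abs_sum_le {ι : Type*} [Fintype ι] [Nonempty ι]
    (A : ι → Matrix (Fin n) (Fin n) ℂ) {f : ℝ → ℝ}
    (hg : GeometricallyConvex f) (hf0 : ∀ t : ℝ, 0 ≤ t → 0 ≤ f t)
    (hf : ConcaveOn ℝ (Set.Ici 0) f) {T : Matrix (Fin n) (Fin n) ℂ} (hT : T.PosSemidef)
    (hTA : T = ∑ i, cfc f (CFC.abs (A i))) {q : ℝ} (hq : 1 ≤ q) :
    (∑ j, f ((posSemidef_abs (∑ i, A i)).isHermitian.eigenvalues j) ^ q) ^ 2 ≤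
      (Fintype.card ι : ℝ) ^ (q - 1) * (∑ j, hT.isHermitian.eigenvalues j ^ q) ^ 2 := by
  have hP : (∑ i, leftAbs (A i)).PosSemidef := posSemidef_sum _ fun i _ => posSemidef_leftAbs (A i)
  have hQ : (∑ i, CFC.abs (A i)).PosSemidef := posSemidef_sum _ fun i _ => posSemidef_abs (A i)
  have hF : (fromBlocks (∑ i, leftAbs (A i)) (∑ i, A i) (∑ i, A i)ᴴ
      (∑ i, CFC.abs (A i))).PosSemidef := by
    rw [conjTranspose_sum, ← fromBlocks_sum]
    exact posSemidef_sum _ fun i _ => posSemidef_fromBlocks_leftAbs_abs (A i)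
  have h1 := sq_sum_rpow_abs_le hP hQ hF hg hf0 hf hq
  have h2 := sum_concave_rpow_le (fun i => posSemidef_abs (A i)) hQ rfl hf hf0 hT hTA hq
  have h3 := sum_concave_rpow_le_card_rpow_mul (fun i => posSemidef_leftAbs (A i)) hP rfl hf hf0 hq
  simp_rw [eigenvalues_leftAbs] at h3
  have h4 := sum_sum_rpow_le (fun i => posSemidef_abs (A i)) hf0 hT hTA hq
  have h5 := h3.trans (mul_le_mul_of_nonneg_left h4 (by positivity))
  have h6 : 0 ≤ ∑ j, hT.isHermitian.eigenvalues j ^ q :=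
    Finset.sum_nonneg fun j _ => Real.rpow_nonneg (hT.eigenvalues_nonneg j) q
  refine h1.trans ((mul_le_mul h5 h2 (Finset.sum_nonneg fun j _ => Real.rpow_nonneg
    (hf0 _ (hQ.eigenvalues_nonneg j)) q) (by positivity)).trans_eq (by ring))

end Matrix

/-- The Schatten `q`-norm for a real exponent `q`. -/
noncomputable def realSchattenNorm {n : ℕ} (q : ℝ) (B : Matrix (Fin n) (Fin n) ℂ) : ℝ :=
  (∑ j : Fin n, matrixSingularValue B j ^ q) ^ (1 / q)

theorem realSchattenNorm_cfc_abs_sum_le {f : ℝ → ℝ} (hg : GeometricallyConvex f)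
    (hf0 : ∀ t : ℝ, 0 ≤ t → 0 ≤ f t) (hf : ConcaveOn ℝ (Set.Ici 0) f)
    {n m : ℕ} (hm : 1 ≤ m) (A : Fin m → Matrix (Fin n) (Fin n) ℂ) {q : ℝ} (hq : 1 ≤ q) :
    realSchattenNorm q (cfc f (CFC.abs (∑ i, A i))) ≤
      √(m : ℝ) ^ (1 - q⁻¹) * realSchattenNorm q (∑ i, cfc f (CFC.abs (A i))) := by
  have hq0 : 0 < q := by linarith
  have : Nonempty (Fin m) := ⟨⟨0, hm⟩⟩
  have hT : (∑ i, cfc f (CFC.abs (A i))).PosSemidef := Matrix.posSemidef_sum _ fun i _ =>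
    Matrix.posSemidef_cfc (Matrix.posSemidef_abs (A i)) hf0
  have hM := Matrix.posSemidef_abs (∑ i, A i)
  have hL := Matrix.posSemidef_cfc hM hf0
  have h := Matrix.sq_sum_rpow_abs_sum_le A hg hf0 hf hT rfl hq
  rw [realSchattenNorm, realSchattenNorm, hL.sum_matrixSingularValue fun x => x ^ q,
    hT.sum_matrixSingularValue fun x => x ^ q,
    hM.isHermitian.sum_eigenvalues_cfc hL.isHermitian f rfl fun x => x ^ q]
  set L := ∑ j, f (hM.isHermitian.eigenvalues j) ^ q
  set R := ∑ j, hT.isHermitian.eigenvalues j ^ q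
  have hL0 : 0 ≤ L :=
    Finset.sum_nonneg fun j _ => Real.rpow_nonneg (hf0 _ (hM.eigenvalues_nonneg j)) q
  have hR0 : 0 ≤ R :=
    Finset.sum_nonneg fun j _ => Real.rpow_nonneg (hT.eigenvalues_nonneg j) q
  rw [Fintype.card_fin] at h
  have h1 : L ≤ √(m : ℝ) ^ (q - 1) * R := by
    refine le_of_sq_le_sq (h.trans_eq ?_) (by positivity)
    rw [mul_pow, ← Real.rpow_natCast (√(m : ℝ) ^ (q - 1)), ← Real.rpow_mul (Real.sqrt_nonneg _),
      mul_comm (q - 1), Real.rpow_mul (Real.sqrt_nonneg _), Real.rpow_natCast,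
      Real.sq_sqrt (Nat.cast_nonneg m)]
  calc L ^ (1 / q) ≤ (√(m : ℝ) ^ (q - 1) * R) ^ (1 / q) :=
        Real.rpow_le_rpow hL0 h1 (by positivity)
    _ = √(m : ℝ) ^ (1 - q⁻¹) * R ^ (1 / q) := by
        rw [Real.mul_rpow (by positivity) hR0, ← Real.rpow_mul (Real.sqrt_nonneg _)]
        congr 2
        field_simp

theorem matrixSingularValue_zero_le_realSchattenNorm {n : ℕ} (B : Matrix (Fin n) (Fin n) ℂ) {q : ℝ}
    (hq : 1 ≤ q) : matrixSingularValue B 0 ≤ realSchattenNorm q B := by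
  have hs : ∀ j, 0 ≤ matrixSingularValue B j := fun j => LinearMap.singularValues_nonneg _ j
  have hq0 : 0 < q := by linarith
  rcases Nat.eq_zero_or_pos n with rfl | hn
  · rw [matrixSingularValue, LinearMap.singularValues_of_finrank_le _ (by simp)]
    exact Real.rpow_nonneg (Finset.sum_nonneg fun (j : Fin 0) _ => Real.rpow_nonneg (hs j) q) _
  · have h := Finset.single_le_sum (f := fun j : Fin n => matrixSingularValue B j ^ q)
      (fun j _ => Real.rpow_nonneg (hs j) q) (Finset.mem_univ ⟨0, hn⟩)
    have h1 := Real.rpow_le_rpow (Real.rpow_nonneg (hs 0) q) h (by positivity : 0 ≤ 1 / q)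
    rwa [← Real.rpow_mul (hs 0), mul_one_div_cancel hq0.ne', Real.rpow_one] at h1

theorem realSchattenNorm_le {n : ℕ} (B : Matrix (Fin n) (Fin n) ℂ) {q : ℝ}
    (hq : 1 ≤ q) : realSchattenNorm q B ≤ (n : ℝ) ^ (1 / q) * matrixSingularValue B 0 := by
  have hs : ∀ j, 0 ≤ matrixSingularValue B j := fun j => LinearMap.singularValues_nonneg _ j
  have hq0 : 0 < q := by linarith
  have h : ∑ j : Fin n, matrixSingularValue B j ^ q ≤ n * matrixSingularValue B 0 ^ q := by
    refine (Finset.sum_le_card_nsmul (Finset.univ : Finset (Fin n)) _ (matrixSingularValue B 0 ^ q) fun j _ =>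
      Real.rpow_le_rpow (hs j) (LinearMap.singularValues_antitone _ (Nat.zero_le j))
        hq0.le).trans_eq ?_
    simp
  refine (Real.rpow_le_rpow (Finset.sum_nonneg fun (j : Fin n) _ => Real.rpow_nonneg (hs j) q) h
    (by positivity)).trans_eq ?_
  rw [Real.mul_rpow (by positivity) (Real.rpow_nonneg (hs 0) q), ← Real.rpow_mul (hs 0),
    mul_one_div_cancel hq0.ne', Real.rpow_one]

/-- The case `q = ∞` is the limit `q → ∞` of the case of finite exponents. -/
theorem matrixSingularValue_zero_cfc_abs_sum_le {f : ℝ → ℝ} (hg : GeometricallyConvex f)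
    (hf0 : ∀ t : ℝ, 0 ≤ t → 0 ≤ f t) (hf : ConcaveOn ℝ (Set.Ici 0) f)
    {n m : ℕ} (hm : 1 ≤ m) (A : Fin m → Matrix (Fin n) (Fin n) ℂ) :
    matrixSingularValue (cfc f (CFC.abs (∑ i, A i))) 0 ≤
      √(m : ℝ) * matrixSingularValue (∑ i, cfc f (CFC.abs (A i))) 0 := by
  rcases Nat.eq_zero_or_pos n with rfl | hn
  · rw [matrixSingularValue, matrixSingularValue,
      LinearMap.singularValues_of_finrank_le _ (by simp),
      LinearMap.singularValues_of_finrank_le _ (by simp), mul_zero]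
  set r := matrixSingularValue (∑ i, cfc f (CFC.abs (A i))) 0
  have hm0 : 0 < √(m : ℝ) := Real.sqrt_pos.2 (by exact_mod_cast hm)
  have hn0 : (0 : ℝ) < n := by exact_mod_cast hn
  have hinv : Filter.Tendsto (fun q : ℝ => q⁻¹) Filter.atTop (nhds 0) := tendsto_inv_atTop_zero
  have hlim : Filter.Tendsto (fun q : ℝ => √(m : ℝ) ^ (1 - q⁻¹) * ((n : ℝ) ^ q⁻¹ * r))
      Filter.atTop (nhds (√(m : ℝ) ^ (1 - 0 : ℝ) * ((n : ℝ) ^ (0 : ℝ) * r))) :=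
    (tendsto_const_nhds.rpow (hinv.const_sub 1) (Or.inl hm0.ne')).mul
      ((tendsto_const_nhds.rpow hinv (Or.inl hn0.ne')).mul_const r)
  rw [sub_zero, Real.rpow_one, Real.rpow_zero, one_mul] at hlim
  refine ge_of_tendsto hlim ?_
  filter_upwards [Filter.eventually_ge_atTop 1] with q hq
  refine (matrixSingularValue_zero_le_realSchattenNorm _ hq).trans
    ((realSchattenNorm_cfc_abs_sum_le hg hf0 hf hm A hq).trans ?_)
  have := realSchattenNorm_le (∑ i, cfc f (CFC.abs (A i))) hq
  rw [one_div] at this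
  gcongr

theorem proposition3p2 (f : ℝ → ℝ) (hf_nonneg : ∀ t : ℝ, 0 ≤ t → 0 ≤ f t)
    (hf_concave : ConcaveOn ℝ (Set.Ici 0) f) (hf_geom : GeometricallyConvex f)
    (n m : ℕ) (hm : 1 ≤ m) (A : Fin m → Matrix (Fin n) (Fin n) ℂ)
    (q : ℝ≥0∞) (hq : 1 ≤ q) :
    schattenNorm q (cfc f (CFC.abs (∑ i, A i))) ≤
      (√(m : ℝ)) ^ (1 - (q⁻¹).toReal) * schattenNorm q (∑ i, cfc f (CFC.abs (A i))) := by
  rcases eq_or_ne q ∞ with rfl | hq'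
  · simp only [schattenNorm, if_true, ENNReal.inv_top, ENNReal.toReal_zero, sub_zero,
      Real.rpow_one]
    exact matrixSingularValue_zero_cfc_abs_sum_le hf_geom hf_nonneg hf_concave hm A
  · simp only [schattenNorm, if_neg hq', ENNReal.toReal_inv]
    exact realSchattenNorm_cfc_abs_sum_le hf_geom hf_nonneg hf_concave hm A
      ((ENNReal.ofReal_le_iff_le_toReal hq').1 (by simpa using hq))
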